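/- Let $m\ge 2$ be an integer and $C$ a real number. There is a constant $C_m>0$, depending only on $m$ and $C$, such that the following holds for all $p,n\ge 1$. Let $\mu\in\mathbb{R}^p$, let $\Sigma\in\mathbb{R}^{p\times p}$ be a covariance (symmetric positive semidefinite) matrix, and let $Y_1,\dots,Y_n$ be i.i.d. with the elliptical distribution of $Y=\mu+\xi\,\Sigma^{1/2}U$, where $U$ is uniform on the unit sphere $\mathbb{S}^{p-1}$ and $\xi\ge 0$ is a random variable independent of $U$ with $\mathbb{E}\xi^2=p$. Write $\theta_k=p^{-k}\,\mathbb{E}\xi^{2k}$ and $r_k=\mathbb{E}\xi^{2k}/\mathbb{E}\chi_p^{2k}$, where $\chi^2_k$ denotes a chi-square variable with $k$ degrees of freedom, and suppose $\mathbb{E}\xi^{4m}<\infty$ and $\theta_{2m}\le C$. Let $\mathcal{A}$ be a nonempty collection of nonempty, pairwise disjoint subsets (blocks) of $\{1,\dots,p\}$ such that $\Sigma_{JJ}$ is positive definite for every $J\in\mathcal{A}$. Let the blockwise aggregation estimator with known $(\mu,\Sigma)$ be $$\widehat\theta_m^{\,B}=\frac{1}{|\mathcal{A}|}\sum_{J\in\mathcal{A}}\frac{1}{n\,c^*_{m,|J|}}\sum_{i=1}^n\bigl\{(Y_{i,J}-\mu_J)^{\mathsf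 T}\Sigma_{JJ}^{-1}(Y_{i,J}-\mu_J)\bigr\}^m,\qquad c^*_{m,K}=p^m\,\mathbb{E}B^m,\quad B\sim\mathrm{Beta}\bigl(\tfrac K2,\tfrac{p-K}2\bigr)$$ (with $B\equiv 1$ if $K=p$). Then $\widehat\theta_m^{\,B}$ has a finite second moment, is unbiased, $\mathbb{E}\,\widehat\theta_m^{\,B}=\theta_m$, and satisfies $$\frac{\mathrm{var}(\widehat\theta_m^{\,B})}{\theta_m^2}\le\frac1n\,\frac{r_{2m}-r_m^2}{r_m^2}+\frac1{np}\,\frac{r_{2m}}{r_m^2}\,\bar h_m(\mathcal{A})+\frac{C_m}{n}\,\frac1{|\mathcal{A}|^2}\sum_{\substack{I,J\in\mathcal{A}\\ I\ne J}}\bigl\|\Sigma_{II}^{-1/2}\,\Sigma_{IJ}\,\Sigma_{JJ}^{-1/2}\bigr\|^2,$$ where $\|\cdot\|$ is the spectral norm, $\bar h_m(\mathcal{A})=\frac{p}{|\mathcal{A}|^2}\sum_{J\in\mathcal{A}}\frac{h_m(|J|)}{|J|}$ and $h_m(k)=\frac{k\,\mathrm{var}(\chi_k^{2m})}{(\mathbb{E}\chi_k^{2m})^2}$.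 -/

import Mathlib

open MeasureTheory ProbabilityTheory Matrix

noncomputable section

namespace BlockwiseAggregation

/-- The square root `M^{1/2}` of a positive semidefinite matrix. -/
def matSqrt {ι : Type*} [Fintype ι] [DecidableEq ι] (M : Matrix ι ι ℝ) : Matrix ι ι ℝ :=
  open scoped MatrixOrder in CFC.sqrt M

/-- The inverse square root `M^{-1/2}` of a positive definite matrix. -/
def matInvSqrt {ι : Type*} [Fintype ι] [DecidableEq ι] (M : Matrix ι ι ℝ) : Matrix ι ι ℝ :=
  (matSqrt M)⁻¹

/-- The spectral norm of a (rectangular) matrix: its operator norm between Euclidean spaces. -/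
def spectralNorm {ι κ : Type*} [Fintype ι] [Fintype κ] [DecidableEq κ] (M : Matrix ι κ ℝ) : ℝ :=
  ‖LinearMap.toContinuousLinearMap (Matrix.toEuclideanLin M)‖

/-- The submatrix with rows in `I` and columns in `J`. -/
def block {p : ℕ} (S : Matrix (Fin p) (Fin p) ℝ) (I J : Finset (Fin p)) : Matrix I J ℝ :=
  S.submatrix Subtype.val Subtype.val

/-- The uniform distribution on the unit sphere of `ℝᵖ`, as a measure on `ℝᵖ`:
the normalized surface measure. -/
def sphereUniform (p : ℕ) : Measure (EuclideanSpace ℝ (Fin p)) :=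
  (((volume : Measure (EuclideanSpace ℝ (Fin p))).toSphere Set.univ)⁻¹ •
    (volume : Measure (EuclideanSpace ℝ (Fin p))).toSphere).map Subtype.val

/-- The elliptical distribution: the law of `μ + ξ S^{1/2} U`, where `ξ` has law `ν` and is
independent of `U`, which is uniform on the unit sphere. -/
def ellipticalLaw {p : ℕ} (μ : EuclideanSpace ℝ (Fin p)) (S : Matrix (Fin p) (Fin p) ℝ)
    (ν : Measure ℝ) : Measure (EuclideanSpace ℝ (Fin p)) :=
  (ν.prod (sphereUniform p)).map
    (fun z => μ + z.1 • Matrix.toEuclideanLin (matSqrt S) z.2)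

/-- The scaled even moment `θ_m = p^{-m} E ξ^{2m}`, where `ξ` has law `ν`. -/
def theta (p : ℕ) (ν : Measure ℝ) (m : ℕ) : ℝ :=
  (∫ x, x ^ (2 * m) ∂ν) / (p : ℝ) ^ m

/-- The chi-square distribution with `k` degrees of freedom. -/
def chiSquare (k : ℕ) : Measure ℝ := gammaMeasure ((k : ℝ) / 2) (1 / 2)

/-- `E χ_k^{2m}`, the `m`-th moment of the chi-square distribution `χ_k^2`. -/
def chiMoment (k m : ℕ) : ℝ := ∫ x, x ^ m ∂(chiSquare k)

/-- `r_k = E ξ^{2k} / E χ_p^{2k}`, where `ξ` has law `ν`. -/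
def momentRatio (p : ℕ) (ν : Measure ℝ) (k : ℕ) : ℝ :=
  (∫ x, x ^ (2 * k) ∂ν) / chiMoment p k

/-- The distribution `Beta(K/2, (p-K)/2)` for `1 ≤ K ≤ p`; it is the point mass at `1` when
`K = p`. -/
def blockBeta (p K : ℕ) : Measure ℝ :=
  if K = p then Measure.dirac 1 else betaMeasure ((K : ℝ) / 2) (((p : ℝ) - K) / 2)

/-- `c*_{m,K} = p^m E B^m`, where `B ~ Beta(K/2, (p-K)/2)`. -/
def cStar (p m K : ℕ) : ℝ := (p : ℝ) ^ m * ∫ x, x ^ m ∂(blockBeta p K)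

/-- The quadratic form `(y_J - μ_J)ᵀ S_JJ⁻¹ (y_J - μ_J)`. -/
def blockQuad {p : ℕ} (μ : EuclideanSpace ℝ (Fin p)) (S : Matrix (Fin p) (Fin p) ℝ)
    (J : Finset (Fin p)) (y : EuclideanSpace ℝ (Fin p)) : ℝ :=
  (fun j : J => y j - μ j) ⬝ᵥ ((block S J J)⁻¹ *ᵥ fun j : J => y j - μ j)

/-- The blockwise estimator attached to the block `J` and the sample `y 0, …, y (n-1)`. -/
def blockEstimator {p n : ℕ} (m : ℕ) (μ : EuclideanSpace ℝ (Fin p))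
    (S : Matrix (Fin p) (Fin p) ℝ) (J : Finset (Fin p))
    (y : Fin n → EuclideanSpace ℝ (Fin p)) : ℝ :=
  1 / ((n : ℝ) * cStar p m J.card) * ∑ i, blockQuad μ S J (y i) ^ m

/-- The blockwise aggregation estimator: the average of the blockwise estimators over `A`. -/
def bae {p n : ℕ} (m : ℕ) (μ : EuclideanSpace ℝ (Fin p)) (S : Matrix (Fin p) (Fin p) ℝ)
    (A : Finset (Finset (Fin p))) (y : Fin n → EuclideanSpace ℝ (Fin p)) : ℝ :=
  1 / (A.card : ℝ) * ∑ J ∈ A, blockEstimator m μ S J y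

/-- `h_m(k) = k var(χ_k^{2m}) / (E χ_k^{2m})²`. -/
def hFactor (m k : ℕ) : ℝ :=
  (k : ℝ) * Var[fun x : ℝ => x ^ m; chiSquare k] / chiMoment k m ^ 2

/-- The block-division factor `(p / |A|²) ∑_{J ∈ A} h_m(|J|) / |J|`. -/
def blockDivisionFactor {p : ℕ} (m : ℕ) (A : Finset (Finset (Fin p))) : ℝ :=
  (p : ℝ) / (A.card : ℝ) ^ 2 * ∑ J ∈ A, hFactor m J.card / (J.card : ℝ)

/-- The sum of `‖S_II^{-1/2} S_IJ S_JJ^{-1/2}‖²` over ordered pairs of distinct blocks. -/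
def crossBlockSum {p : ℕ} (S : Matrix (Fin p) (Fin p) ℝ) (A : Finset (Finset (Fin p))) : ℝ :=
  ∑ q ∈ A.offDiag,
    spectralNorm (matInvSqrt (block S q.1 q.1) * block S q.1 q.2 *
      matInvSqrt (block S q.2 q.2)) ^ 2

end BlockwiseAggregation

end

/-! Write `W_J = S_JJ^{-1/2} (S^{1/2})_{J,·}`. Then `W_J W_Jᵀ = 1`, and the quadratic form of block
`J` at `Y = μ + ξ S^{1/2} U` equals `ξ² ‖W_J U‖²`. So one observation contributes `ξ^{2m} D(U)` with
`D` homogeneous, and the moments split into a radial and a directional factor. A Gaussian vector has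
independent norm and direction, so a spherical moment of a homogeneous function is its Gaussian
moment divided by a chi moment (`integral_homogeneous_stdGaussian`). Since `W_J` maps a standard
Gaussian to a standard Gaussian, `c*` is exactly the normalization that gives unbiasedness.

The second moment of `D` is a sum over pairs of blocks. After normalization, a diagonal pair gives
`1 + h_m(|J|)/|J|`. An off-diagonal pair gives at most `1 + c_m ρ²`, where `ρ = ‖W_I W_Jᵀ‖` is the
spectral norm in the statement. The common factor `r_{2m}/r_m²` is at most `θ_{2m} ≤ C`, by `(E
χ_p^{2m})² ≤ E χ_p^{4m}` and `E ξ^{2m} ≥ p^m`.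

The core is the off-diagonal bound `integral_norm_pow_mul_norm_pow_le`. Split `M = ρV + N` along the
range of `Lᵀ`, so that `N` is independent of `L`. The reflection in that range preserves the
Gaussian law, fixes `L` and turns `ρV + N` into `ρV - N`. Averaging over it removes the terms odd in
`ρ`, leaving an error of order `ρ²` with a constant free of dimension. -/

noncomputable section

namespace BlockwiseAggregation

/-! ### Gaussian density and polar coordinates -/

section Gaussian

variable {E : Type*} [NormedAddCommGroup E] [InnerProductSpace ℝ E] [FiniteDimensional ℝ E]
  [MeasurableSpace E] [BorelSpace E]

/-- The density of the standard Gaussian measure, as a function of the norm. -/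
def gaussianRadialDensity (d : ℕ) (r : ℝ) : ℝ :=
  (2 * Real.pi) ^ (-(d : ℝ) / 2) * Real.exp (-(1 / 2) * r ^ 2)

lemma gaussianRadialDensity_nonneg (d : ℕ) (r : ℝ) : 0 ≤ gaussianRadialDensity d r := by
  unfold gaussianRadialDensity; positivity

@[fun_prop]
lemma continuous_gaussianRadialDensity (d : ℕ) : Continuous (gaussianRadialDensity d) := by
  unfold gaussianRadialDensity; fun_prop

lemma integral_gaussianDensity :
    ∫ x : E, gaussianRadialDensity (Module.finrank ℝ E) ‖x‖ = 1 := by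
  simp only [gaussianRadialDensity]
  rw [integral_const_mul, GaussianFourier.integral_rexp_neg_mul_sq_norm (by norm_num),
    show Real.pi / (1 / 2) = 2 * Real.pi by ring, ← Real.rpow_add (by positivity)]
  simp [neg_div]

/-- A non-integrable function has Bochner integral `0` by convention, whereas this integral is `1`.
-/
lemma integrable_gaussianDensity :
    Integrable (fun x : E => gaussianRadialDensity (Module.finrank ℝ E) ‖x‖) := by
  by_contra h
  have := integral_gaussianDensity (E := E)
  rw [integral_undef h] at this
  exact zero_ne_one this

lemma stdGaussian_eq_withDensity :
    stdGaussian E = (volume : Measure E).withDensity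
      (fun x => ENNReal.ofReal (gaussianRadialDensity (Module.finrank ℝ E) ‖x‖)) := by
  have : IsFiniteMeasure ((volume : Measure E).withDensity
      (fun x => ENNReal.ofReal (gaussianRadialDensity (Module.finrank ℝ E) ‖x‖))) :=
    isFiniteMeasure_withDensity_ofReal integrable_gaussianDensity.2
  apply Measure.ext_of_charFun
  ext t
  rw [charFun_stdGaussian, charFun_apply,
    integral_withDensity_eq_integral_toReal_smul (by fun_prop) (by simp)]
  have h : ∀ x : E, (ENNReal.ofReal (gaussianRadialDensity (Module.finrank ℝ E) ‖x‖)).toReal •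
      Complex.exp ((inner ℝ x t : ℝ) * Complex.I) =
      ((2 * Real.pi) ^ (-(Module.finrank ℝ E : ℝ) / 2) : ℝ) *
        Complex.exp (-(1 / 2 : ℂ) * (‖x‖ : ℂ) ^ 2 + Complex.I * (inner ℝ t x : ℝ)) := by
    intro x
    rw [ENNReal.toReal_ofReal (gaussianRadialDensity_nonneg _ _), gaussianRadialDensity,
      Complex.exp_add, Complex.real_smul, real_inner_comm]
    push_cast
    ring_nf
  simp_rw [h]
  rw [integral_const_mul, GaussianFourier.integral_cexp_neg_mul_sq_norm_add (by norm_num)]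
  rw [show (Real.pi : ℂ) / (1 / 2) = ((2 * Real.pi : ℝ) : ℂ) by push_cast; ring,
    show ((Module.finrank ℝ E : ℂ) / 2) = (((Module.finrank ℝ E : ℝ) / 2 : ℝ) : ℂ) by push_cast; ring,
    ← Complex.ofReal_cpow (by positivity), ← mul_assoc, ← Complex.ofReal_mul,
    ← Real.rpow_add (by positivity)]
  simp only [neg_div, neg_add_cancel, Real.rpow_zero, Complex.ofReal_one, one_mul, Complex.I_sq]
  congr 1
  ring

lemma integral_stdGaussian (F : E → ℝ) :
    ∫ x, F x ∂(stdGaussian E) =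
      ∫ x, gaussianRadialDensity (Module.finrank ℝ E) ‖x‖ * F x := by
  rw [stdGaussian_eq_withDensity,
    integral_withDensity_eq_integral_toReal_smul (by fun_prop) (by simp)]
  simp [ENNReal.toReal_ofReal (gaussianRadialDensity_nonneg _ _)]

/-- Polar coordinates for positively homogeneous functions. -/
lemma integral_radial_mul_homogeneous [Nontrivial E] (w : ℝ → ℝ) {d : ℕ} {F : E → ℝ}
    (hF : ∀ r : ℝ, 0 < r → ∀ x, F (r • x) = r ^ d * F x) :
    ∫ x, w ‖x‖ * F x = (∫ u : Metric.sphere (0 : E) 1, F u ∂(volume : Measure E).toSphere) *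
      ∫ r : Set.Ioi (0 : ℝ), w r * r.1 ^ d ∂(Measure.volumeIoiPow (Module.finrank ℝ E - 1)) := by
  rw [← integral_prod_mul, ← (Measure.measurePreserving_homeomorphUnitSphereProd
    (volume : Measure E)).integral_comp (Homeomorph.measurableEmbedding _)]
  -- The origin is null, and off it `x ↦ (x/‖x‖, ‖x‖)` is a homeomorphism carrying volume to a
  -- product measure.
  rw [← restrict_compl_singleton (μ := (volume : Measure E)) 0,
    ← integral_subtype_comap (measurableSet_singleton _).compl (fun x => w ‖x‖ * F x)]
  simp only [restrict_compl_singleton]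
  refine integral_congr_ae (Filter.Eventually.of_forall fun x => ?_)
  have hx : 0 < ‖x.1‖ := norm_pos_iff.2 x.2
  simp only [homeomorphUnitSphereProd_apply_snd_coe, homeomorphUnitSphereProd_apply_fst_coe]
  have := hF ‖x.1‖⁻¹ (by positivity) x.1
  rw [this, inv_pow]
  field_simp

end Gaussian

/-- Integrals of homogeneous functions factor into a radial and a spherical part. -/
lemma integral_homogeneous_stdGaussian {p : ℕ} (hp : 0 < p) {d : ℕ}
    {F : EuclideanSpace ℝ (Fin p) → ℝ} (hFm : Measurable F)
    (hF : ∀ r : ℝ, 0 < r → ∀ x, F (r • x) = r ^ d * F x) :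
    ∫ x, F x ∂(stdGaussian (EuclideanSpace ℝ (Fin p))) =
      (∫ x, ‖x‖ ^ d ∂(stdGaussian (EuclideanSpace ℝ (Fin p)))) *
        ∫ u, F u ∂(sphereUniform p) := by
  have : Nonempty (Fin p) := ⟨⟨0, hp⟩⟩
  have hσ : (volume : Measure (EuclideanSpace ℝ (Fin p))).toSphere Set.univ ≠ 0 := by
    rw [Ne, Measure.measure_univ_eq_zero]
    exact Measure.toSphere_ne_zero _
  -- `F` and `‖x‖ ^ d` have the same degree, hence the same radial factor; only the spherical
  -- integrals differ.
  rw [integral_stdGaussian, integral_stdGaussian, integral_radial_mul_homogeneous _ hF,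
    integral_radial_mul_homogeneous (d := d) (F := fun x => ‖x‖ ^ d) _
      (fun r hr x => by rw [norm_smul, mul_pow, Real.norm_of_nonneg hr.le]),
    sphereUniform, integral_map (by fun_prop) hFm.aestronglyMeasurable, integral_smul_measure]
  simp only [norm_eq_of_mem_sphere, one_pow, integral_const, smul_eq_mul, mul_one,
    ENNReal.toReal_inv]
  rw [← measureReal_def]
  have : (volume : Measure (EuclideanSpace ℝ (Fin p))).toSphere.real Set.univ ≠ 0 := by
    rw [measureReal_def]
    exact ENNReal.toReal_ne_zero.2 ⟨hσ, measure_ne_top _ _⟩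
  field_simp

lemma isProbabilityMeasure_sphereUniform {p : ℕ} (hp : 0 < p) :
    IsProbabilityMeasure (sphereUniform p) := by
  have : Nonempty (Fin p) := ⟨⟨0, hp⟩⟩
  have hσ : (volume : Measure (EuclideanSpace ℝ (Fin p))).toSphere Set.univ ≠ 0 := by
    rw [Ne, Measure.measure_univ_eq_zero]
    exact Measure.toSphere_ne_zero _
  refine ⟨?_⟩
  rw [sphereUniform, Measure.map_apply measurable_subtype_coe MeasurableSet.univ]
  simpa using ENNReal.inv_mul_cancel hσ (measure_ne_top _ _)

/-! ### Chi-square and Beta moments -/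

section Chi

/-- `x ^ m` times the density of shape `a` is a multiple of the density of shape `a + m`, which has
mass `1`. -/
lemma integral_pow_gammaMeasure {a r : ℝ} (ha : 0 < a) (hr : 0 < r) (m : ℕ) :
    ∫ x, x ^ m ∂(gammaMeasure a r) = Real.Gamma (a + m) / (r ^ m * Real.Gamma a) := by
  have ham : 0 < a + m := by positivity
  have h1 : ∀ b : ℝ, ∀ g : ℝ → ℝ, 0 < b →
      ∫ x, g x ∂(gammaMeasure b r) = ∫ x, gammaPDFReal b r x * g x := by
    intro b g hb
    rw [gammaMeasure, integral_withDensity_eq_integral_toReal_smul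
      (by unfold gammaPDF; exact (measurable_gammaPDFReal b r).ennreal_ofReal)
      (by simp [gammaPDF])]
    simp [gammaPDF, ENNReal.toReal_ofReal (gammaPDFReal_nonneg hb hr _)]
  have h2 : ∫ x, gammaPDFReal (a + m) r x = 1 := by
    have := isProbabilityMeasure_gammaMeasure ham hr
    have h := h1 (a + m) (fun _ => 1) ham
    simpa using h.symm
  have := (Real.Gamma_pos_of_pos ha).ne'
  have := (Real.Gamma_pos_of_pos ham).ne'
  rw [h1 a _ ha, ← mul_one (Real.Gamma (a + m) / _), ← h2, ← integral_const_mul]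
  refine integral_congr_ae ?_
  filter_upwards [compl_mem_ae_iff.2 (measure_singleton (0 : ℝ))] with x hx
  unfold gammaPDFReal
  split_ifs with hx0
  · have hx' : 0 < x := lt_of_le_of_ne hx0 (Ne.symm hx)
    rw [show a + m - 1 = (a - 1) + m by ring, Real.rpow_add_natCast hx'.ne',
      Real.rpow_add_natCast hr.ne']
    field_simp
  · simp

lemma chiMoment_eq {k : ℕ} (hk : 0 < k) (m : ℕ) :
    chiMoment k m = 2 ^ m * Real.Gamma ((k : ℝ) / 2 + m) / Real.Gamma ((k : ℝ) / 2) := by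
  have : 0 < (k : ℝ) := by exact_mod_cast hk
  rw [chiMoment, chiSquare, integral_pow_gammaMeasure (by positivity) (by norm_num)]
  have := (Real.Gamma_pos_of_pos (half_pos this)).ne'
  simp
  field_simp

lemma chiMoment_pos {k : ℕ} (hk : 0 < k) (m : ℕ) : 0 < chiMoment k m := by
  have : 0 < (k : ℝ) := by exact_mod_cast hk
  rw [chiMoment_eq hk]
  have := Real.Gamma_pos_of_pos (half_pos this)
  have := Real.Gamma_pos_of_pos (show 0 < (k : ℝ) / 2 + m by positivity)
  positivity

lemma integral_pow_betaMeasure {α β : ℝ} (hα : 0 < α) (hβ : 0 < β) (m : ℕ) :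
    ∫ x, x ^ m ∂(betaMeasure α β) = beta (α + m) β / beta α β := by
  have ham : 0 < α + m := by positivity
  have hnn : ∀ a : ℝ, 0 < a → ∀ x, 0 ≤ betaPDFReal a β x := by
    intro a ha x
    by_cases h : 0 < x ∧ x < 1
    · exact (betaPDFReal_pos h.1 h.2 ha hβ).le
    · simp [betaPDFReal, h]
  have h1 : ∀ b : ℝ, ∀ g : ℝ → ℝ, 0 < b →
      ∫ x, g x ∂(betaMeasure b β) = ∫ x, betaPDFReal b β x * g x := by
    intro b g hb
    rw [betaMeasure, integral_withDensity_eq_integral_toReal_smul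
      (by unfold betaPDF; exact (measurable_betaPDFReal b β).ennreal_ofReal)
      (by simp [betaPDF])]
    simp [betaPDF, ENNReal.toReal_ofReal (hnn b hb _)]
  have h2 : ∫ x, betaPDFReal (α + m) β x = 1 := by
    have := isProbabilityMeasureBeta ham hβ
    have h := h1 (α + m) (fun _ => 1) ham
    simpa using h.symm
  have := (beta_pos hα hβ).ne'
  have := (beta_pos ham hβ).ne'
  rw [h1 α _ hα, ← mul_one (beta (α + m) β / _), ← h2, ← integral_const_mul]
  refine integral_congr_ae (Filter.Eventually.of_forall fun x => ?_)
  simp only [betaPDFReal]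
  split_ifs with hx0
  · rw [show α + m - 1 = (α - 1) + m by ring, Real.rpow_add_natCast hx0.1.ne']
    field_simp
  · simp

/-- The factors `Γ((p-K)/2)` cancel in the ratio of Beta functions; for `K = p` both sides reduce to
`p ^ m`. -/
lemma cStar_eq {p K : ℕ} (hK : 0 < K) (hKp : K ≤ p) (m : ℕ) :
    cStar p m K = (p : ℝ) ^ m * (chiMoment K m / chiMoment p m) := by
  have hp : 0 < p := hK.trans_le hKp
  rw [cStar, blockBeta]
  split_ifs with h
  · subst h
    simp [div_self (chiMoment_pos hK m).ne']
  · have hlt : (K : ℝ) < p := by exact_mod_cast lt_of_le_of_ne hKp h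
    have hK' : 0 < (K : ℝ) := by exact_mod_cast hK
    have hp' : 0 < (p : ℝ) := by exact_mod_cast hp
    rw [integral_pow_betaMeasure (by positivity) (by linarith), chiMoment_eq hK, chiMoment_eq hp,
      beta, beta]
    rw [show (K : ℝ) / 2 + m + (p - K) / 2 = p / 2 + m by ring,
      show (K : ℝ) / 2 + (p - K) / 2 = p / 2 by ring]
    have h1 := (Real.Gamma_pos_of_pos (half_pos hp')).ne'
    have h2 := (Real.Gamma_pos_of_pos (half_pos hK')).ne'
    have h3 := (Real.Gamma_pos_of_pos (show 0 < ((p : ℝ) - K) / 2 by linarith)).ne'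
    have h4 := (Real.Gamma_pos_of_pos (show 0 < (p : ℝ) / 2 + m by positivity)).ne'
    field_simp

lemma integral_norm_pow_stdGaussian {ι : Type*} [Fintype ι] [Nonempty ι] (m : ℕ) :
    ∫ x, ‖x‖ ^ (2 * m) ∂(stdGaussian (EuclideanSpace ℝ ι)) = chiMoment (Fintype.card ι) m := by
  have hk : 0 < Fintype.card ι := Fintype.card_pos
  set k := Fintype.card ι
  have hk' : 0 < (k : ℝ) := by exact_mod_cast hk
  set D : ℝ := (k : ℝ) * (volume : Measure (EuclideanSpace ℝ ι)).real (Metric.ball 0 1) *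
    (2 * Real.pi) ^ (-(k : ℝ) / 2)
  have key : ∀ l : ℕ, ∫ x, ‖x‖ ^ (2 * l) ∂(stdGaussian (EuclideanSpace ℝ ι)) =
      D * ((1 / 2 : ℝ) ^ (-((k : ℝ) / 2)) * (1 / 2)) *
        (2 ^ l * Real.Gamma ((k : ℝ) / 2 + l)) := by
    intro l
    rw [integral_stdGaussian, integral_fun_norm_addHaar volume
      (fun r => gaussianRadialDensity (Module.finrank ℝ (EuclideanSpace ℝ ι)) r * r ^ (2 * l)),
      finrank_euclideanSpace]
    have h : ∀ y ∈ Set.Ioi (0 : ℝ), y ^ (k - 1) • (gaussianRadialDensity k y * y ^ (2 * l)) =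
        (2 * Real.pi) ^ (-(k : ℝ) / 2) *
          (y ^ ((k : ℝ) - 1 + 2 * l) * Real.exp (-(1 / 2) * y ^ (2 : ℝ))) := by
      intro y hy
      have hy : 0 < y := hy
      have : (k : ℝ) - 1 + 2 * l = ((k - 1 + 2 * l : ℕ) : ℝ) := by
        push_cast [Nat.cast_sub hk]; ring
      rw [this, Real.rpow_natCast, Real.rpow_two, gaussianRadialDensity, smul_eq_mul, pow_add]
      ring
    rw [setIntegral_congr_fun measurableSet_Ioi h, integral_const_mul,
      integral_rpow_mul_exp_neg_mul_rpow (by norm_num) (by linarith [(Nat.cast_nonneg l : (0 : ℝ) ≤ l)])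
        (by norm_num)]
    rw [show -((k : ℝ) - 1 + 2 * l + 1) / 2 = -((k : ℝ) / 2) + -(l : ℝ) by ring,
      show ((k : ℝ) - 1 + 2 * l + 1) / 2 = (k : ℝ) / 2 + l by ring,
      Real.rpow_add (by norm_num), Real.rpow_neg (by norm_num) (l : ℝ), Real.rpow_natCast]
    simp only [nsmul_eq_mul, smul_eq_mul, D, one_div, inv_pow, inv_inv]
    ring
  -- The case `l = 0` is the total mass `1`; it eliminates `D`, so the volume of the ball is never
  -- computed.
  have h0 := key 0
  have hG := Real.Gamma_pos_of_pos (half_pos hk')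
  simp only [mul_zero, pow_zero, integral_const, probReal_univ, smul_eq_mul, mul_one, one_mul,
    Nat.cast_zero, add_zero] at h0
  rw [key m, chiMoment_eq hk, eq_div_iff hG.ne']
  linear_combination (-2 ^ m * Real.Gamma ((k : ℝ) / 2 + m)) * h0

end Chi

/-! ### Gaussian vectors under coisometries and contractions -/

section Maps

open ContinuousLinearMap

variable {E F : Type*} [NormedAddCommGroup E] [InnerProductSpace ℝ E] [FiniteDimensional ℝ E]
  [NormedAddCommGroup F] [InnerProductSpace ℝ F] [FiniteDimensional ℝ F]

lemma norm_adjoint_of_coisometry {L : E →L[ℝ] F} (hL : L ∘L adjoint L = .id ℝ F) (t : F) :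
    ‖adjoint L t‖ = ‖t‖ := by
  have h : ‖adjoint L t‖ ^ 2 = ‖t‖ ^ 2 := by
    rw [← real_inner_self_eq_norm_sq, adjoint_inner_left, ← ContinuousLinearMap.comp_apply, hL,
      ContinuousLinearMap.id_apply, real_inner_self_eq_norm_sq]
  exact (pow_left_inj₀ (norm_nonneg _) (norm_nonneg _) two_ne_zero).1 h

lemma norm_le_one_of_coisometry {L : E →L[ℝ] F} (hL : L ∘L adjoint L = .id ℝ F) : ‖L‖ ≤ 1 := by
  rw [← LinearIsometryEquiv.norm_map (adjoint (𝕜 := ℝ) (E := E) (F := F)) L]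
  exact opNorm_le_bound _ zero_le_one fun t => by rw [norm_adjoint_of_coisometry hL, one_mul]

variable [MeasurableSpace E] [BorelSpace E]

lemma stdGaussian_map_coisometry [MeasurableSpace F] [BorelSpace F] {L : E →L[ℝ] F} (hL : L ∘L adjoint L = .id ℝ F) :
    (stdGaussian E).map L = stdGaussian F := by
  have : IsProbabilityMeasure ((stdGaussian E).map L) :=
    Measure.isProbabilityMeasure_map (by fun_prop)
  apply Measure.ext_of_charFun
  ext t
  rw [charFun_stdGaussian, charFun_apply, integral_map (by fun_prop) (by fun_prop),
    ← norm_adjoint_of_coisometry hL t, ← charFun_stdGaussian, charFun_apply]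
  simp_rw [← adjoint_inner_right]

/-- The even moments of the standard Gaussian variable. -/
def gaussianMoment (q : ℕ) : ℝ := ∫ x, x ^ (2 * q) ∂(gaussianReal 0 1)

lemma gaussianMoment_nonneg (q : ℕ) : 0 ≤ gaussianMoment q :=
  integral_nonneg fun x => (even_two_mul q).pow_nonneg x

lemma integral_dual_pow_stdGaussian (l : StrongDual ℝ E) (q : ℕ) :
    ∫ x, l x ^ (2 * q) ∂(stdGaussian E) = ‖l‖ ^ (2 * q) * gaussianMoment q := by
  have h1 : (stdGaussian E).map l = (gaussianReal 0 1).map (‖l‖ * ·) := by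
    rw [IsGaussian.map_eq_gaussianReal, integral_strongDual_stdGaussian,
      variance_dual_stdGaussian, gaussianReal_map_const_mul]
    congr 1
    · simp
    · ext; simp
  calc ∫ x, l x ^ (2 * q) ∂(stdGaussian E)
      = ∫ y, y ^ (2 * q) ∂((stdGaussian E).map l) := by
        rw [integral_map (by fun_prop) (by fun_prop)]
    _ = _ := by
        rw [h1, integral_map (by fun_prop) (by fun_prop), gaussianMoment, ← integral_const_mul]
        simp_rw [mul_pow]

lemma integrable_norm_pow_stdGaussian (d : ℕ) :
    Integrable (fun x : E => ‖x‖ ^ d) (stdGaussian E) := by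
  rcases eq_or_ne d 0 with rfl | hd
  · simp
  · exact (IsGaussian.memLp_id (stdGaussian E) d (by simp)).integrable_norm_pow hd

lemma integrable_of_abs_le_norm_pow {f : E → ℝ} (hf : Continuous f) {c : ℝ} {d : ℕ}
    (h : ∀ x, |f x| ≤ c * ‖x‖ ^ d) : Integrable f (stdGaussian E) :=
  ((integrable_norm_pow_stdGaussian d).const_mul c).mono' hf.aestronglyMeasurable
    (Filter.Eventually.of_forall h)

lemma integrable_norm_clm_pow {G : Type*} [NormedAddCommGroup G] [InnerProductSpace ℝ G]
    (L : E →L[ℝ] G) (d : ℕ) :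
    Integrable (fun x => ‖L x‖ ^ d) (stdGaussian E) := by
  refine integrable_of_abs_le_norm_pow (by fun_prop) (c := ‖L‖ ^ d) (d := d) fun x => ?_
  rw [abs_of_nonneg (by positivity), ← mul_pow]
  exact pow_le_pow_left₀ (norm_nonneg _) (L.le_opNorm x) _

/-- Power means reduce the norm to its coordinates, each a Gaussian variable of variance at most
`1`. -/
lemma integral_norm_clm_pow_le {ι : Type*} [Fintype ι] (L : E →L[ℝ] EuclideanSpace ℝ ι)
    (hL : ‖L‖ ≤ 1) (q : ℕ) :
    ∫ x, ‖L x‖ ^ (2 * q) ∂(stdGaussian E) ≤ (Fintype.card ι : ℝ) ^ q * gaussianMoment q := by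
  rcases q with _ | q
  · simp [gaussianMoment]
  have hi : ∀ i, ‖(EuclideanSpace.proj i : EuclideanSpace ℝ ι →L[ℝ] ℝ) ∘L L‖ ≤ 1 := fun i =>
    opNorm_le_bound _ zero_le_one fun x =>
      (PiLp.norm_apply_le (L x) i).trans (L.le_of_opNorm_le hL x)
  have hint : ∀ i, Integrable (fun x => (L x i) ^ (2 * (q + 1))) (stdGaussian E) := fun i => by
    refine integrable_of_abs_le_norm_pow (by fun_prop) (c := 1) (d := 2 * (q + 1)) fun x => ?_
    rw [abs_pow, one_mul]
    refine pow_le_pow_left₀ (abs_nonneg _) ?_ _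
    simpa using ((PiLp.norm_apply_le (L x) i).trans (L.le_of_opNorm_le hL x))
  calc ∫ x, ‖L x‖ ^ (2 * (q + 1)) ∂(stdGaussian E)
      ≤ ∫ x, (Fintype.card ι : ℝ) ^ q * ∑ i, (L x i) ^ (2 * (q + 1)) ∂(stdGaussian E) := by
        refine integral_mono (integrable_norm_clm_pow L _)
          ((integrable_finsetSum _ fun i _ => hint i).const_mul _) fun x => ?_
        have h := pow_sum_div_card_le_sum_pow (s := Finset.univ) (f := fun i => (L x i) ^ 2)
          (n := q) (fun i _ => sq_nonneg _)
        simp only [pow_mul, EuclideanSpace.real_norm_sq_eq]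
        rcases isEmpty_or_nonempty ι with hE | hE
        · simp
        rw [div_le_iff₀ (by rw [Finset.card_univ]; have : 0 < Fintype.card ι := Fintype.card_pos
                            positivity)] at h
        rw [Finset.card_univ] at h
        linarith
    _ = (Fintype.card ι : ℝ) ^ q *
          ∑ i, ∫ x, ((EuclideanSpace.proj i : EuclideanSpace ℝ ι →L[ℝ] ℝ) ∘L L) x
            ^ (2 * (q + 1)) ∂(stdGaussian E) := by
        rw [integral_const_mul, integral_finsetSum _ fun i _ => hint i]
        rfl
    _ ≤ (Fintype.card ι : ℝ) ^ q * ∑ i : ι, gaussianMoment (q + 1) := by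
        gcongr with i
        rw [integral_dual_pow_stdGaussian]
        exact mul_le_of_le_one_left (gaussianMoment_nonneg _) (pow_le_one₀ (norm_nonneg _) (hi i))
    _ = _ := by
        simp only [Finset.sum_const, Finset.card_univ, nsmul_eq_mul]
        ring

end Maps

/-- Raising `m` by one multiplies the moment by `k + 2m ≥ k`. This absorbs the powers of the
dimension in the error term. -/
lemma pow_le_chiMoment {k : ℕ} (hk : 0 < k) (m : ℕ) : (k : ℝ) ^ m ≤ chiMoment k m := by
  have hk' : 0 < (k : ℝ) := by exact_mod_cast hk
  induction m with
  | zero =>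
    rw [chiMoment_eq hk]
    simp [div_self (Real.Gamma_pos_of_pos (half_pos hk')).ne']
  | succ m ih =>
    have h : chiMoment k (m + 1) = (k + 2 * m) * chiMoment k m := by
      rw [chiMoment_eq hk, chiMoment_eq hk]
      push_cast
      rw [← add_assoc, Real.Gamma_add_one (by positivity)]
      ring
    rw [h, pow_succ, mul_comm]
    exact mul_le_mul (by linarith [(Nat.cast_nonneg m : (0 : ℝ) ≤ m)]) ih (by positivity)
      (by positivity)

/-! ### Cancellation of the terms odd in `ρ` -/

section Symmetrization

variable {F : Type*} [NormedAddCommGroup F] [InnerProductSpace ℝ F]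

/-- The odd and even parts in `b` satisfy a coupled recursion, so both bounds are proved in one
induction: `b` times an odd part of order `ρ` is of order `ρ²`. The step closes because `m² + m + 1
≤ (m + 1)²`. -/
lemma half_sum_pow_le {a b c T ρ : ℝ} (hρ : 0 ≤ ρ) (ha : 0 ≤ a) (haT : a ≤ T)
    (hc : |c| ≤ ρ ^ 2 * T) (hb : |b| ≤ ρ * T) (h1 : |a + c + b| ≤ T) (h2 : |a + c - b| ≤ T)
    (m : ℕ) :
    |((a + c + b) ^ m - (a + c - b) ^ m) / 2| ≤ m * ρ * T ^ m ∧
    ((a + c + b) ^ m + (a + c - b) ^ m) / 2 ≤ a ^ m + ρ ^ 2 * m ^ 2 * T ^ m := by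
  have hT : 0 ≤ T := ha.trans haT
  induction m with
  | zero => simp
  | succ m ih =>
    obtain ⟨iho, ihe⟩ := ih
    set P := a + c + b
    set Q := a + c - b
    have hev : |(P ^ m + Q ^ m) / 2| ≤ T ^ m := by
      have hP : |P ^ m| ≤ T ^ m := by rw [abs_pow]; exact pow_le_pow_left₀ (abs_nonneg _) h1 m
      have hQ : |Q ^ m| ≤ T ^ m := by rw [abs_pow]; exact pow_le_pow_left₀ (abs_nonneg _) h2 m
      rw [abs_le] at hP hQ ⊢
      constructor <;> linarith
    have hac : |a + c| ≤ T := by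
      rw [abs_le] at h1 h2 ⊢
      constructor <;> (simp only [P, Q] at h1 h2; linarith)
    have hTm : 0 ≤ T ^ m := by positivity
    constructor
    · have : (P ^ (m + 1) - Q ^ (m + 1)) / 2 =
          (a + c) * ((P ^ m - Q ^ m) / 2) + b * ((P ^ m + Q ^ m) / 2) := by
        simp only [P, Q]; ring
      rw [this]
      refine (abs_add_le _ _).trans ?_
      rw [abs_mul, abs_mul]
      have e1 := mul_le_mul hac iho (abs_nonneg _) hT
      have e2 := mul_le_mul hb hev (abs_nonneg _) (by positivity)
      push_cast
      calc _ ≤ _ := add_le_add e1 e2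
        _ = _ := by ring
    · have : (P ^ (m + 1) + Q ^ (m + 1)) / 2 =
          a * ((P ^ m + Q ^ m) / 2) + c * ((P ^ m + Q ^ m) / 2) + b * ((P ^ m - Q ^ m) / 2) := by
        simp only [P, Q]; ring
      rw [this]
      have e0 := mul_le_mul_of_nonneg_left ihe ha
      have e1 : c * ((P ^ m + Q ^ m) / 2) ≤ ρ ^ 2 * T * T ^ m :=
        (le_abs_self _).trans (by rw [abs_mul]; exact mul_le_mul hc hev (abs_nonneg _) (by positivity))
      have e2 : b * ((P ^ m - Q ^ m) / 2) ≤ ρ * T * (m * ρ * T ^ m) :=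
        (le_abs_self _).trans (by rw [abs_mul]; exact mul_le_mul hb iho (abs_nonneg _) (by positivity))
      have e3 : a * (ρ ^ 2 * m ^ 2 * T ^ m) ≤ T * (ρ ^ 2 * m ^ 2 * T ^ m) :=
        mul_le_mul_of_nonneg_right haT (by positivity)
      have e4 : 0 ≤ (m : ℝ) * (ρ ^ 2 * T ^ (m + 1)) := by positivity
      push_cast
      have e5 : a * (a ^ m + ρ ^ 2 * m ^ 2 * T ^ m) =
          a ^ (m + 1) + a * (ρ ^ 2 * m ^ 2 * T ^ m) := by ring
      have e6 : ρ ^ 2 * ((m : ℝ) + 1) ^ 2 * T ^ (m + 1) =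
          T * (ρ ^ 2 * m ^ 2 * T ^ m) + ρ ^ 2 * T * T ^ m + ρ * T * (m * ρ * T ^ m) +
            m * (ρ ^ 2 * T ^ (m + 1)) := by ring
      linarith

lemma norm_add_sub_pow_le (v N : F) {ρ : ℝ} (hρ : 0 ≤ ρ) (hρ1 : ρ ≤ 1) (m : ℕ) :
    (‖ρ • v + N‖ ^ (2 * m) + ‖ρ • v - N‖ ^ (2 * m)) / 2 ≤
      ‖N‖ ^ (2 * m) + ρ ^ 2 * m ^ 2 * (‖v‖ + ‖N‖) ^ (2 * m) := by
  have hρv : ρ * ‖v‖ ≤ ‖v‖ := mul_le_of_le_one_left (norm_nonneg _) hρ1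
  have hn : ‖ρ • v‖ = ρ * ‖v‖ := by rw [norm_smul, Real.norm_of_nonneg hρ]
  have hp : ‖ρ • v + N‖ ^ 2 = ‖N‖ ^ 2 + ρ ^ 2 * ‖v‖ ^ 2 + 2 * ρ * inner ℝ v N := by
    rw [norm_add_sq_real, hn, real_inner_smul_left]; ring
  have hm : ‖ρ • v - N‖ ^ 2 = ‖N‖ ^ 2 + ρ ^ 2 * ‖v‖ ^ 2 - 2 * ρ * inner ℝ v N := by
    rw [norm_sub_sq_real, hn, real_inner_smul_left]; ring
  have hv := norm_nonneg v
  have hN := norm_nonneg N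
  have hi := abs_real_inner_le_norm v N
  simp only [pow_mul]
  rw [hp, hm]
  -- Here `a = ‖N‖²`, `c = ρ²‖v‖²`, `b = 2ρ⟨v, N⟩` and `T = (‖v‖ + ‖N‖)²`.
  refine (half_sum_pow_le hρ (by positivity) ?_ ?_ ?_ ?_ ?_ m).2
  · nlinarith [mul_nonneg hv hN]
  · rw [abs_of_nonneg (by positivity)]
    exact mul_le_mul_of_nonneg_left (by nlinarith [mul_nonneg hv hN]) (by positivity)
  · rw [abs_mul, abs_of_nonneg (by positivity : 0 ≤ 2 * ρ)]
    have : 2 * |inner ℝ v N| ≤ (‖v‖ + ‖N‖) ^ 2 := by nlinarith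
    calc 2 * ρ * |inner ℝ v N| = ρ * (2 * |inner ℝ v N|) := by ring
      _ ≤ _ := mul_le_mul_of_nonneg_left this hρ
  · rw [← hp, abs_of_nonneg (by positivity)]
    exact pow_le_pow_left₀ (norm_nonneg _) ((norm_add_le _ _).trans (by rw [hn]; linarith)) 2
  · rw [← hm, abs_of_nonneg (by positivity)]
    exact pow_le_pow_left₀ (norm_nonneg _) ((norm_sub_le _ _).trans (by rw [hn]; linarith)) 2

/-- `N` is half the difference of `u + N` and `u - N`; apply the triangle inequality and convexity
of the power. -/
lemma norm_pow_le_symmetrized (u N : F) (m : ℕ) :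
    ‖N‖ ^ (2 * m) ≤ (‖u + N‖ ^ (2 * m) + ‖u - N‖ ^ (2 * m)) / 2 := by
  have h : ‖N‖ ≤ (‖u + N‖ + ‖u - N‖) / 2 := by
    have h := norm_sub_le (u + N) (u - N)
    rw [show u + N - (u - N) = (2 : ℝ) • N by rw [two_smul]; abel, norm_smul] at h
    norm_num at h
    linarith
  have h2 := add_pow_le (norm_nonneg (u + N)) (norm_nonneg (u - N)) (2 * m)
  rcases m with _ | m
  · simp
  calc ‖N‖ ^ (2 * (m + 1)) ≤ ((‖u + N‖ + ‖u - N‖) / 2) ^ (2 * (m + 1)) :=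
        pow_le_pow_left₀ (norm_nonneg _) h _
    _ ≤ _ := by
        rw [div_pow, div_le_div_iff₀ (by positivity) (by norm_num)]
        have : (2 : ℝ) ^ (2 * (m + 1)) = 2 ^ (2 * (m + 1) - 1) * 2 := by
          rw [← pow_succ]; congr 1
        rw [this]
        nlinarith

end Symmetrization

/-! ### The correlation bound -/

section Correlation

open ContinuousLinearMap

variable {E : Type*} [NormedAddCommGroup E] [InnerProductSpace ℝ E] [FiniteDimensional ℝ E]
  [MeasurableSpace E] [BorelSpace E]

/-- The constant in the correlation bound for even powers of norms of Gaussian vectors. -/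
def correlationConst (m : ℕ) : ℝ := m ^ 2 * (2 ^ (4 * m + 1) * gaussianMoment (2 * m))

lemma correlationConst_nonneg (m : ℕ) : 0 ≤ correlationConst m := by
  have := gaussianMoment_nonneg (2 * m)
  unfold correlationConst
  positivity

lemma integral_norm_coisometry_pow {ι : Type*} [Fintype ι] [Nonempty ι]
    {L : E →L[ℝ] EuclideanSpace ℝ ι} (hL : L ∘L adjoint L = .id ℝ _) (m : ℕ) :
    ∫ x, ‖L x‖ ^ (2 * m) ∂(stdGaussian E) = chiMoment (Fintype.card ι) m := by
  rw [← integral_norm_pow_stdGaussian (ι := ι), ← stdGaussian_map_coisometry hL,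
    integral_map (by fun_prop) (by fun_prop)]

lemma integrable_norm_clm_pow_mul {G H : Type*} [NormedAddCommGroup G] [InnerProductSpace ℝ G]
    [NormedAddCommGroup H] [InnerProductSpace ℝ H] (L : E →L[ℝ] G) (M : E →L[ℝ] H) (a b : ℕ) :
    Integrable (fun x => ‖L x‖ ^ a * ‖M x‖ ^ b) (stdGaussian E) := by
  refine integrable_of_abs_le_norm_pow (by fun_prop) (c := ‖L‖ ^ a * ‖M‖ ^ b) (d := a + b)
    fun x => ?_
  rw [abs_of_nonneg (by positivity), pow_add]
  calc ‖L x‖ ^ a * ‖M x‖ ^ b ≤ (‖L‖ * ‖x‖) ^ a * (‖M‖ * ‖x‖) ^ b := by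
        gcongr
        · exact L.le_opNorm x
        · exact M.le_opNorm x
    _ = _ := by ring

/-- Cauchy–Schwarz for even powers of norms of three Gaussian vectors, two of which live in the
same space. -/
lemma integral_norm_pow_mul_add_norm_pow_le {ι κ : Type*} [Fintype ι] [Fintype κ]
    [Nonempty ι] [Nonempty κ]
    {L : E →L[ℝ] EuclideanSpace ℝ ι} {V N : E →L[ℝ] EuclideanSpace ℝ κ}
    (hL : ‖L‖ ≤ 1) (hV : ‖V‖ ≤ 1) (hN : ‖N‖ ≤ 1) (m : ℕ) :
    Integrable (fun x => ‖L x‖ ^ (2 * m) * (‖V x‖ + ‖N x‖) ^ (2 * m)) (stdGaussian E) ∧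
    ∫ x, ‖L x‖ ^ (2 * m) * (‖V x‖ + ‖N x‖) ^ (2 * m) ∂(stdGaussian E) ≤
      2 ^ (4 * m + 1) * gaussianMoment (2 * m) *
        ((Fintype.card ι : ℝ) ^ m * (Fintype.card κ : ℝ) ^ m) := by
  have hLx : ∀ x, ‖L x‖ ≤ ‖x‖ := fun x => by simpa using L.le_of_opNorm_le hL x
  have hVx : ∀ x, ‖V x‖ ≤ ‖x‖ := fun x => by simpa using V.le_of_opNorm_le hV x
  have hNx : ∀ x, ‖N x‖ ≤ ‖x‖ := fun x => by simpa using N.le_of_opNorm_le hN x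
  have hint : Integrable (fun x => ‖L x‖ ^ (2 * m) * (‖V x‖ + ‖N x‖) ^ (2 * m))
      (stdGaussian E) := by
    refine integrable_of_abs_le_norm_pow (by fun_prop) (c := 2 ^ (2 * m)) (d := 4 * m) fun x => ?_
    rw [abs_of_nonneg (by positivity)]
    calc ‖L x‖ ^ (2 * m) * (‖V x‖ + ‖N x‖) ^ (2 * m)
        ≤ ‖x‖ ^ (2 * m) * (‖x‖ + ‖x‖) ^ (2 * m) := by
          gcongr
          · exact hLx x
          · exact hVx x
          · exact hNx x
      _ = _ := by rw [← two_mul, mul_pow, show 4 * m = 2 * m + 2 * m by ring, pow_add]; ring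
  refine ⟨hint, ?_⟩
  set k : ℝ := ((Fintype.card ι : ℕ) : ℝ)
  set l : ℝ := ((Fintype.card κ : ℕ) : ℝ)
  have hk : 0 < k := by simp only [k]; exact_mod_cast Fintype.card_pos
  have hl : 0 < l := by simp only [l]; exact_mod_cast Fintype.card_pos
  set M := gaussianMoment (2 * m)
  have hM : 0 ≤ M := gaussianMoment_nonneg _
  have eL : ∫ x, ‖L x‖ ^ (4 * m) ∂(stdGaussian E) ≤ k ^ (2 * m) * M := by
    have := integral_norm_clm_pow_le L hL (2 * m)
    rwa [show 2 * (2 * m) = 4 * m by ring] at this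
  have eV : ∫ x, ‖V x‖ ^ (4 * m) ∂(stdGaussian E) ≤ l ^ (2 * m) * M := by
    have := integral_norm_clm_pow_le V hV (2 * m)
    rwa [show 2 * (2 * m) = 4 * m by ring] at this
  have eN : ∫ x, ‖N x‖ ^ (4 * m) ∂(stdGaussian E) ≤ l ^ (2 * m) * M := by
    have := integral_norm_clm_pow_le N hN (2 * m)
    rwa [show 2 * (2 * m) = 4 * m by ring] at this
  -- Weighted AM-GM; the weights make both terms of order `k ^ m * l ^ m` after integration.
  have hpt : ∀ x, ‖L x‖ ^ (2 * m) * (‖V x‖ + ‖N x‖) ^ (2 * m) ≤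
      (l ^ m / k ^ m) / 2 * ‖L x‖ ^ (4 * m) +
        (k ^ m / l ^ m) / 2 * (2 ^ (4 * m) * (‖V x‖ ^ (4 * m) + ‖N x‖ ^ (4 * m))) := by
    intro x
    have h1 : (‖V x‖ + ‖N x‖) ^ (4 * m) ≤
        2 ^ (4 * m) * (‖V x‖ ^ (4 * m) + ‖N x‖ ^ (4 * m)) :=
      (add_pow_le (norm_nonneg (V x)) (norm_nonneg (N x)) (4 * m)).trans <|
        mul_le_mul_of_nonneg_right (pow_le_pow_right₀ one_le_two (Nat.sub_le _ _)) (by positivity)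
    have h2 : (k ^ m / l ^ m) / 2 * (‖V x‖ + ‖N x‖) ^ (4 * m) ≤
        (k ^ m / l ^ m) / 2 * (2 ^ (4 * m) * (‖V x‖ ^ (4 * m) + ‖N x‖ ^ (4 * m))) :=
      mul_le_mul_of_nonneg_left h1 (by positivity)
    refine le_trans ?_ (add_le_add_right h2 _)
    rw [show 4 * m = 2 * m * 2 by ring, pow_mul _ (2 * m) 2, pow_mul _ (2 * m) 2]
    set f := ‖L x‖ ^ (2 * m)
    set g := (‖V x‖ + ‖N x‖) ^ (2 * m)
    have hkm : 0 < k ^ m := by positivity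
    have hlm : 0 < l ^ m := by positivity
    rw [div_div, div_div, div_mul_eq_mul_div, div_mul_eq_mul_div,
      div_add_div _ _ (by positivity) (by positivity), le_div_iff₀ (by positivity)]
    nlinarith [sq_nonneg (l ^ m * f - k ^ m * g)]
  have hi1 := integrable_norm_clm_pow L (4 * m)
  have hi2 := integrable_norm_clm_pow V (4 * m)
  have hi3 := integrable_norm_clm_pow N (4 * m)
  have hi1' := hi1.const_mul (l ^ m / k ^ m / 2)
  have hi23' := ((hi2.add hi3).const_mul (2 ^ (4 * m))).const_mul (k ^ m / l ^ m / 2)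
  calc ∫ x, ‖L x‖ ^ (2 * m) * (‖V x‖ + ‖N x‖) ^ (2 * m) ∂(stdGaussian E)
      ≤ _ := integral_mono hint
        (hi1'.add hi23') hpt
    _ = (l ^ m / k ^ m) / 2 * ∫ x, ‖L x‖ ^ (4 * m) ∂(stdGaussian E) +
        (k ^ m / l ^ m) / 2 * (2 ^ (4 * m) * (∫ x, ‖V x‖ ^ (4 * m) ∂(stdGaussian E) +
          ∫ x, ‖N x‖ ^ (4 * m) ∂(stdGaussian E))) := by
        rw [← integral_add hi2 hi3, ← integral_const_mul, ← integral_const_mul,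
          ← integral_const_mul]
        exact integral_add hi1' hi23'
    _ ≤ (l ^ m / k ^ m) / 2 * (k ^ (2 * m) * M) +
        (k ^ m / l ^ m) / 2 * (2 ^ (4 * m) * (l ^ (2 * m) * M + l ^ (2 * m) * M)) := by
        gcongr
    _ = (1 + 2 ^ (4 * m) * 2) / 2 * (M * (k ^ m * l ^ m)) := by
        rw [two_mul m, pow_add, pow_add]
        field_simp
        ring
    _ ≤ 2 ^ (4 * m + 1) * (M * (k ^ m * l ^ m)) := by
        refine mul_le_mul_of_nonneg_right ?_ (by positivity)
        have h2 : (1 : ℝ) ≤ 2 ^ (4 * m) := one_le_pow₀ (by norm_num)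
        rw [pow_succ]
        linarith
    _ = _ := by ring

/-- The correlation of even powers of the norms of two standard Gaussian vectors is at most of the
order of the squared norm of their cross-covariance. -/
lemma integral_norm_pow_mul_norm_pow_le {ι κ : Type*} [Fintype ι] [Fintype κ]
    [Nonempty ι] [Nonempty κ]
    {L : E →L[ℝ] EuclideanSpace ℝ ι} {M : E →L[ℝ] EuclideanSpace ℝ κ}
    (hL : L ∘L adjoint L = .id ℝ _) (hM : M ∘L adjoint M = .id ℝ _) (m : ℕ) :
    ∫ x, ‖L x‖ ^ (2 * m) * ‖M x‖ ^ (2 * m) ∂(stdGaussian E) ≤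
      (1 + correlationConst m * ‖M ∘L adjoint L‖ ^ 2) *
        (chiMoment (Fintype.card ι) m * chiMoment (Fintype.card κ) m) := by
  set ρ := ‖M ∘L adjoint L‖
  have hρ : 0 ≤ ρ := norm_nonneg _
  have hL1 := norm_le_one_of_coisometry hL
  have hM1 := norm_le_one_of_coisometry hM
  have hρ1 : ρ ≤ 1 := (opNorm_comp_le _ _).trans <| by
    rw [LinearIsometryEquiv.norm_map]
    exact mul_le_one₀ hM1 (norm_nonneg _) hL1
  -- `Q` is the orthogonal projection onto the range of `adjoint L`, and `S` below is the reflection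
  -- fixing that range.
  set Q : E →L[ℝ] E := adjoint L ∘L L
  have hQs : adjoint Q = Q := by simp [Q, adjoint_comp]
  have hLL : ∀ y, L (adjoint L y) = y := fun y => by
    rw [← ContinuousLinearMap.comp_apply, hL, ContinuousLinearMap.id_apply]
  have hLQ : ∀ x, L (Q x) = L x := fun x => by simp [Q, hLL]
  have hQQ : ∀ x, Q (Q x) = Q x := fun x => by simp [Q, hLL]
  set S : E →L[ℝ] E := (2 : ℝ) • Q - .id ℝ E
  have hS : ∀ x, S x = (2 : ℝ) • Q x - x := fun x => by simp [S]
  have hSs : adjoint S = S := by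
    ext x
    refine ext_inner_right ℝ fun y => ?_
    rw [adjoint_inner_left, hS, hS, inner_sub_left, inner_sub_right, inner_smul_left,
      inner_smul_right, ← adjoint_inner_left, hQs]
    simp
  have hSS : S ∘L adjoint S = .id ℝ E := by
    rw [hSs]
    ext x
    rw [ContinuousLinearMap.comp_apply, hS, hS, map_sub, Q.map_smul, hQQ,
      ContinuousLinearMap.id_apply]
    module
  have hS1 := norm_le_one_of_coisometry hSS
  set N : E →L[ℝ] EuclideanSpace ℝ κ := M ∘L (.id ℝ E - Q)
  have hN : ∀ x, N x = M x - M (Q x) := fun x => by simp [N]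
  have hN1 : ‖N‖ ≤ 1 := opNorm_le_bound _ zero_le_one fun x => by
    have h : N x = (1 / 2 : ℝ) • M (x - S x) := by
      rw [hN, hS, ← map_sub, ← map_smul]
      congr 1
      module
    rw [h, norm_smul, one_mul]
    have h1 := M.le_of_opNorm_le hM1 (x - S x)
    have h2 := S.le_of_opNorm_le hS1 x
    have h3 := norm_sub_le x (S x)
    rw [show ‖(1 / 2 : ℝ)‖ = 1 / 2 by norm_num]
    linarith
  -- If `ρ = 0`, then `ρ⁻¹ = 0` and `V = 0`, which is harmless because `M ∘L Q` vanishes too.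
  set V : E →L[ℝ] EuclideanSpace ℝ κ := ρ⁻¹ • (M ∘L Q)
  have hMQ : ∀ x, ‖M (Q x)‖ ≤ ρ * ‖x‖ := fun x => by
    have h1 := (M ∘L adjoint L).le_opNorm (L x)
    have h2 := L.le_of_opNorm_le hL1 x
    calc ‖M (Q x)‖ ≤ ρ * ‖L x‖ := h1
      _ ≤ ρ * ‖x‖ := mul_le_mul_of_nonneg_left (by simpa using h2) hρ
  have hV : ∀ x, ρ • V x = M (Q x) := fun x => by
    rcases eq_or_ne ρ 0 with h | h
    · have := hMQ x
      rw [h, zero_mul] at this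
      rw [h, zero_smul, norm_le_zero_iff.1 this]
    · simp [V, smul_smul, h]
  have hV1 : ‖V‖ ≤ 1 := opNorm_le_bound _ zero_le_one fun x => by
    simp only [V, _root_.smul_apply, ContinuousLinearMap.comp_apply, norm_smul,
      norm_inv, Real.norm_of_nonneg hρ, one_mul]
    rcases eq_or_ne ρ 0 with h | h
    · simp [h]
    · rw [inv_mul_le_iff₀ (by positivity)]
      exact hMQ x
  have hMx : ∀ x, M x = ρ • V x + N x := fun x => by rw [hV, hN]; abel
  have hMS : ∀ x, M (S x) = ρ • V x - N x := fun x => by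
    rw [hV, hN, hS, map_sub, map_smul, two_smul]; abel
  have hLS : ∀ x, L (S x) = L x := fun x => by
    rw [hS, map_sub, map_smul, hLQ, two_smul]; abel
  have hrefl : ∀ f : E → ℝ, Continuous f →
      ∫ x, f (S x) ∂(stdGaussian E) = ∫ x, f x ∂(stdGaussian E) := fun f hf => by
    nth_rewrite 2 [← stdGaussian_map_coisometry hSS]
    rw [integral_map (by fun_prop) hf.aestronglyMeasurable]
  -- independence of `L x` and `N x`
  have hind : IndepFun L N (stdGaussian E) := by
    have hg : HasGaussianLaw (fun x => (L x, N x)) (stdGaussian E) :=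
      ⟨by
        have : IsGaussian ((stdGaussian E).map (L.prod N)) := inferInstance
        exact this⟩
    -- For jointly Gaussian vectors zero covariance suffices, and `N ∘L adjoint L = 0`.
    refine hg.indepFun_of_covariance_inner fun a b => ?_
    have h1 : ∀ x, inner ℝ a (L x) = inner ℝ (adjoint L a) x := fun x =>
      (adjoint_inner_left L x a).symm
    have h2 : ∀ x, inner ℝ b (N x) = inner ℝ (adjoint N b) x := fun x =>
      (adjoint_inner_left N x b).symm
    simp_rw [h1, h2]
    rw [← covarianceBilin_apply_eq_cov IsGaussian.memLp_two_id, covarianceBilin_stdGaussian,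
      innerSL_apply_apply, adjoint_inner_right, hN]
    have : Q (adjoint L a) = adjoint L a := by simp [Q, hLL]
    rw [this, sub_self, inner_zero_left]
  set γ := stdGaussian E
  have hprod : ∫ x, ‖L x‖ ^ (2 * m) * ‖N x‖ ^ (2 * m) ∂γ =
      chiMoment (Fintype.card ι) m * ∫ x, ‖N x‖ ^ (2 * m) ∂γ := by
    rw [← integral_norm_coisometry_pow hL m]
    exact (hind.comp (φ := fun y => ‖y‖ ^ (2 * m)) (ψ := fun y => ‖y‖ ^ (2 * m))
      (by fun_prop) (by fun_prop)).integral_fun_mul_eq_mul_integral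
      (by fun_prop) (by fun_prop)
  have hiS : Integrable (fun x => ‖M (S x)‖ ^ (2 * m)) γ := integrable_norm_clm_pow (M ∘L S) _
  -- `N` is half the difference of `M` and `M ∘L S`, each of which has a standard Gaussian image.
  have hNle : ∫ x, ‖N x‖ ^ (2 * m) ∂γ ≤ chiMoment (Fintype.card κ) m := by
    have hi := integrable_norm_clm_pow M (2 * m)
    calc ∫ x, ‖N x‖ ^ (2 * m) ∂γ
        ≤ ∫ x, (‖M x‖ ^ (2 * m) + ‖M (S x)‖ ^ (2 * m)) / 2 ∂γ := by
          refine integral_mono (integrable_norm_clm_pow N _) ((hi.add hiS).div_const 2) fun x => ?_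
          simp only [hMx x, hMS x]
          exact norm_pow_le_symmetrized _ _ _
      _ = chiMoment (Fintype.card κ) m := by
          rw [integral_div, integral_add hi hiS,
            hrefl (fun x => ‖M x‖ ^ (2 * m)) (by fun_prop), integral_norm_coisometry_pow hM m]
          ring
  obtain ⟨hTi, hT⟩ := integral_norm_pow_mul_add_norm_pow_le hL1 hV1 hN1 m
  have hi := integrable_norm_clm_pow_mul L M (2 * m) (2 * m)
  have hi' : Integrable (fun x => ‖L (S x)‖ ^ (2 * m) * ‖M (S x)‖ ^ (2 * m)) γ :=
    integrable_norm_clm_pow_mul (L ∘L S) (M ∘L S) (2 * m) (2 * m)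
  have hiN := integrable_norm_clm_pow_mul L N (2 * m) (2 * m)
  have hkpos : 0 < Fintype.card ι := Fintype.card_pos
  have hlpos : 0 < Fintype.card κ := Fintype.card_pos
  have hc1 := chiMoment_pos hkpos m
  have hc2 := chiMoment_pos hlpos m
  have hG := gaussianMoment_nonneg (2 * m)
  calc ∫ x, ‖L x‖ ^ (2 * m) * ‖M x‖ ^ (2 * m) ∂γ
      = ∫ x, (‖L x‖ ^ (2 * m) * ‖M x‖ ^ (2 * m) +
          ‖L (S x)‖ ^ (2 * m) * ‖M (S x)‖ ^ (2 * m)) / 2 ∂γ := by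
        rw [integral_div, integral_add hi hi',
          hrefl (fun x => ‖L x‖ ^ (2 * m) * ‖M x‖ ^ (2 * m)) (by fun_prop)]
        ring
    _ ≤ ∫ x, (‖L x‖ ^ (2 * m) * ‖N x‖ ^ (2 * m) +
          ρ ^ 2 * m ^ 2 * (‖L x‖ ^ (2 * m) * (‖V x‖ + ‖N x‖) ^ (2 * m))) ∂γ := by
        refine integral_mono ((hi.add hi').div_const 2) (hiN.add (hTi.const_mul _)) fun x => ?_
        have h := mul_le_mul_of_nonneg_left (norm_add_sub_pow_le (V x) (N x) hρ hρ1 m)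
          (by positivity : 0 ≤ ‖L x‖ ^ (2 * m))
        simp only [hLS, hMx x, hMS x]
        calc _ = _ := by ring
          _ ≤ _ := h
          _ = _ := by ring
    _ = chiMoment (Fintype.card ι) m * ∫ x, ‖N x‖ ^ (2 * m) ∂γ +
          ρ ^ 2 * m ^ 2 * ∫ x, ‖L x‖ ^ (2 * m) * (‖V x‖ + ‖N x‖) ^ (2 * m) ∂γ := by
        rw [integral_add hiN (hTi.const_mul _), integral_const_mul, hprod]
    _ ≤ chiMoment (Fintype.card ι) m * chiMoment (Fintype.card κ) m +
          ρ ^ 2 * m ^ 2 * (2 ^ (4 * m + 1) * gaussianMoment (2 * m) *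
            (chiMoment (Fintype.card ι) m * chiMoment (Fintype.card κ) m)) := by
        refine add_le_add (mul_le_mul_of_nonneg_left hNle hc1.le)
          (mul_le_mul_of_nonneg_left (hT.trans ?_) (by positivity))
        exact mul_le_mul_of_nonneg_left (mul_le_mul (pow_le_chiMoment hkpos m)
          (pow_le_chiMoment hlpos m) (by positivity) hc1.le) (by positivity)
    _ = _ := by unfold correlationConst; ring

end Correlation

/-! ### Matrix square roots -/

section MatrixRoots

variable {ι : Type*} [Fintype ι] [DecidableEq ι] {M : Matrix ι ι ℝ}

open scoped MatrixOrder in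
lemma matSqrt_mul_self (hM : M.PosSemidef) : matSqrt M * matSqrt M = M :=
  CFC.sqrt_mul_sqrt_self M hM.nonneg

open scoped MatrixOrder in
lemma transpose_matSqrt (M : Matrix ι ι ℝ) : (matSqrt M)ᵀ = matSqrt M := by
  have h : (matSqrt M).PosSemidef := nonneg_iff_posSemidef.1 (CFC.sqrt_nonneg M)
  simpa [IsHermitian, conjTranspose_eq_transpose_of_trivial] using h.isHermitian

lemma transpose_matInvSqrt (M : Matrix ι ι ℝ) : (matInvSqrt M)ᵀ = matInvSqrt M := by
  rw [matInvSqrt, transpose_nonsing_inv, transpose_matSqrt]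

lemma matInvSqrt_mul_self (hM : M.PosSemidef) : matInvSqrt M * matInvSqrt M = M⁻¹ := by
  rw [matInvSqrt, ← Matrix.mul_inv_rev, matSqrt_mul_self hM]

lemma matInvSqrt_mul_mul_matInvSqrt (hM : M.PosDef) : matInvSqrt M * M * matInvSqrt M = 1 := by
  have hs := matSqrt_mul_self hM.posSemidef
  have hdet : IsUnit (matSqrt M).det := by
    have h : IsUnit M.det := (isUnit_iff_isUnit_det M).1 hM.isUnit
    rw [← hs, det_mul] at h
    exact isUnit_of_mul_isUnit_left h
  nth_rewrite 2 [← hs]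
  rw [matInvSqrt, ← mul_assoc, nonsing_inv_mul _ hdet, one_mul, mul_nonsing_inv _ hdet]

end MatrixRoots

/-! ### Whitening maps of blocks -/

section BlockMap

variable {p : ℕ} {S : Matrix (Fin p) (Fin p) ℝ}

/-- The matrix `S_JJ^{-1/2} (S^{1/2})_{J,·}`. -/
def whitening (S : Matrix (Fin p) (Fin p) ℝ) (J : Finset (Fin p)) : Matrix J (Fin p) ℝ :=
  matInvSqrt (block S J J) * (matSqrt S).submatrix (Subtype.val : J → Fin p) (id : Fin p → Fin p)

/-- The rows of `S^{1/2}` have Gram matrix `S`. For `I = J` this yields the coisometry, for `I ≠ J`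
the matrix in the cross-block term. -/
lemma whitening_mul_transpose (hS : S.PosSemidef) (I J : Finset (Fin p)) :
    whitening S I * (whitening S J)ᵀ =
      matInvSqrt (block S I I) * block S I J * matInvSqrt (block S J J) := by
  have h : (matSqrt S).submatrix (Subtype.val : I → Fin p) id *
      ((matSqrt S).submatrix (Subtype.val : J → Fin p) id)ᵀ = block S I J := by
    rw [transpose_submatrix, transpose_matSqrt, ← submatrix_mul _ _ _ _ _ Function.bijective_id,
      matSqrt_mul_self hS, block]
  rw [whitening, whitening, transpose_mul, transpose_matInvSqrt, ← h]
  simp only [Matrix.mul_assoc]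

/-- The operator with matrix `whitening S J`. -/
def whiteningMap (S : Matrix (Fin p) (Fin p) ℝ) (J : Finset (Fin p)) :
    EuclideanSpace ℝ (Fin p) →L[ℝ] EuclideanSpace ℝ J :=
  LinearMap.toContinuousLinearMap (toEuclideanLin (whitening S J))

lemma whiteningMap_comp_adjoint (I J : Finset (Fin p)) :
    whiteningMap S I ∘L ContinuousLinearMap.adjoint (whiteningMap S J) =
      LinearMap.toContinuousLinearMap (toEuclideanLin (whitening S I * (whitening S J)ᵀ)) := by
  rw [whiteningMap, whiteningMap, ← LinearMap.adjoint_toContinuousLinearMap,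
    ← toEuclideanLin_conjTranspose_eq_adjoint, conjTranspose_eq_transpose_of_trivial,
    toLpLin_mul_same]
  rfl

lemma whiteningMap_coisometry (hS : S.PosSemidef) {J : Finset (Fin p)}
    (hJ : (block S J J).PosDef) :
    whiteningMap S J ∘L ContinuousLinearMap.adjoint (whiteningMap S J) = .id ℝ _ := by
  rw [whiteningMap_comp_adjoint, whitening_mul_transpose hS, matInvSqrt_mul_mul_matInvSqrt hJ,
    toLpLin_one]
  rfl

lemma norm_whiteningMap_comp_adjoint (hS : S.PosSemidef) (I J : Finset (Fin p)) :
    ‖whiteningMap S I ∘L ContinuousLinearMap.adjoint (whiteningMap S J)‖ =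
      spectralNorm (matInvSqrt (block S I I) * block S I J * matInvSqrt (block S J J)) := by
  rw [whiteningMap_comp_adjoint, whitening_mul_transpose hS, spectralNorm]

lemma blockQuad_elliptical {J : Finset (Fin p)} (hJ : (block S J J).PosSemidef)
    (μ u : EuclideanSpace ℝ (Fin p)) (x : ℝ) :
    blockQuad μ S J (μ + x • toEuclideanLin (matSqrt S) u) =
      x ^ 2 * ‖whiteningMap S J u‖ ^ 2 := by
  set w : J → ℝ := (matSqrt S).submatrix Subtype.val id *ᵥ u.ofLp
  have h1 : (fun j : J => (μ + x • toEuclideanLin (matSqrt S) u) j - μ j) = x • w := by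
    ext j
    simp [w, toLpLin_apply, mulVec, dotProduct]
  have h2 : (whiteningMap S J u).ofLp = matInvSqrt (block S J J) *ᵥ w := by
    simp only [whiteningMap, LinearMap.coe_toContinuousLinearMap', toLpLin_apply, whitening, w,
      mulVec_mulVec]
  rw [blockQuad, h1, EuclideanSpace.real_norm_sq_eq, h2, ← matInvSqrt_mul_self hJ, mulVec_smul,
    smul_dotProduct, dotProduct_smul, ← mulVec_mulVec, dotProduct_mulVec,
    ← mulVec_transpose, transpose_matInvSqrt]
  simp only [smul_eq_mul, dotProduct, pow_two, Finset.mul_sum, mul_assoc]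

end BlockMap

/-! ### Spherical moments of whitened blocks -/

section SphereMoments

variable {p : ℕ} {S : Matrix (Fin p) (Fin p) ℝ}

lemma integrable_sphereUniform {f : EuclideanSpace ℝ (Fin p) → ℝ} (hf : Continuous f) :
    Integrable f (sphereUniform p) := by
  rw [sphereUniform, integrable_map_measure hf.aestronglyMeasurable (by fun_prop)]
  rcases eq_or_ne ((volume : Measure (EuclideanSpace ℝ (Fin p))).toSphere Set.univ) 0 with h | h
  · rw [Measure.measure_univ_eq_zero.1 h]
    simp
  · refine Integrable.smul_measure ?_ (ENNReal.inv_ne_top.2 h)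
    exact (hf.comp continuous_subtype_val).integrable_of_hasCompactSupport
      (HasCompactSupport.of_compactSpace _)

lemma integral_norm_whiteningMap_pow (hS : S.PosSemidef) {J : Finset (Fin p)}
    (hJ : (block S J J).PosDef) (hne : J.Nonempty) (m : ℕ) :
    ∫ u, ‖whiteningMap S J u‖ ^ (2 * m) ∂(sphereUniform p) =
      chiMoment J.card m / chiMoment p m := by
  have hp : 0 < p := (Fin.pos hne.choose)
  have : Nonempty (Fin p) := ⟨hne.choose⟩
  have : Nonempty J := hne.to_subtype
  have h := integral_homogeneous_stdGaussian hp (d := 2 * m)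
    (F := fun u => ‖whiteningMap S J u‖ ^ (2 * m)) (by fun_prop) fun r hr x => by
      rw [map_smul, norm_smul, mul_pow, Real.norm_of_nonneg hr.le]
  rw [integral_norm_coisometry_pow (whiteningMap_coisometry hS hJ), integral_norm_pow_stdGaussian,
    Fintype.card_coe, Fintype.card_fin] at h
  rw [h, mul_div_cancel_left₀ _ (chiMoment_pos hp m).ne']

lemma integral_norm_whiteningMap_pow_mul_le (hS : S.PosSemidef) {I J : Finset (Fin p)}
    (hI : (block S I I).PosDef) (hJ : (block S J J).PosDef) (hIne : I.Nonempty)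
    (hJne : J.Nonempty) (m : ℕ) :
    ∫ u, ‖whiteningMap S I u‖ ^ (2 * m) * ‖whiteningMap S J u‖ ^ (2 * m) ∂(sphereUniform p) ≤
      (1 + correlationConst m * spectralNorm (matInvSqrt (block S I I) * block S I J *
        matInvSqrt (block S J J)) ^ 2) * (chiMoment I.card m * chiMoment J.card m) /
          chiMoment p (2 * m) := by
  have hp : 0 < p := (Fin.pos hIne.choose)
  have : Nonempty (Fin p) := ⟨hIne.choose⟩
  have : Nonempty I := hIne.to_subtype
  have : Nonempty J := hJne.to_subtype
  have h := integral_homogeneous_stdGaussian hp (d := 2 * (2 * m))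
    (F := fun u => ‖whiteningMap S I u‖ ^ (2 * m) * ‖whiteningMap S J u‖ ^ (2 * m))
      (by fun_prop) fun r hr x => by
        rw [map_smul, map_smul, norm_smul, norm_smul, mul_pow, mul_pow, Real.norm_of_nonneg hr.le]
        ring
  -- With `J` in the role of `L` and `I` in that of `M`, the cross-covariance is `S_II^{-1/2} S_IJ
  -- S_JJ^{-1/2}` rather than its transpose.
  have hle := integral_norm_pow_mul_norm_pow_le (whiteningMap_coisometry hS hJ)
    (whiteningMap_coisometry hS hI) m
  rw [norm_whiteningMap_comp_adjoint hS] at hle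
  simp_rw [mul_comm (‖whiteningMap S J _‖ ^ (2 * m))] at hle
  rw [h, integral_norm_pow_stdGaussian, Fintype.card_coe, Fintype.card_coe, Fintype.card_fin] at hle
  rw [le_div_iff₀ (chiMoment_pos hp _)]
  linarith

lemma integral_norm_whiteningMap_pow_mul_self (hS : S.PosSemidef) {J : Finset (Fin p)}
    (hJ : (block S J J).PosDef) (hne : J.Nonempty) (m : ℕ) :
    ∫ u, ‖whiteningMap S J u‖ ^ (2 * m) * ‖whiteningMap S J u‖ ^ (2 * m) ∂(sphereUniform p) =
      chiMoment J.card (2 * m) / chiMoment p (2 * m) := by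
  rw [← integral_norm_whiteningMap_pow hS hJ hne]
  congr 1
  ext u
  rw [← pow_add]
  ring

end SphereMoments

/-! ### Chi variances and radial moments -/

section ChiVariance

lemma variance_pow_chiSquare {k : ℕ} (hk : 0 < k) (m : ℕ) :
    Var[fun x : ℝ => x ^ m; chiSquare k] = chiMoment k (2 * m) - chiMoment k m ^ 2 := by
  have : IsProbabilityMeasure (chiSquare k) :=
    isProbabilityMeasure_gammaMeasure (by positivity) (by norm_num)
  have hi : Integrable (fun x : ℝ => x ^ (2 * m)) (chiSquare k) :=
    Integrable.of_integral_ne_zero (chiMoment_pos hk (2 * m)).ne'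
  have hL : MemLp (fun x : ℝ => x ^ m) 2 (chiSquare k) := by
    rw [memLp_two_iff_integrable_sq (by fun_prop)]
    simpa only [← pow_mul, mul_comm m 2] using hi
  rw [variance_eq_sub hL]
  simp only [Pi.pow_apply, ← pow_mul, mul_comm m 2, chiMoment]

lemma sq_chiMoment_le {k : ℕ} (hk : 0 < k) (m : ℕ) : chiMoment k m ^ 2 ≤ chiMoment k (2 * m) := by
  have h := variance_nonneg (fun x : ℝ => x ^ m) (chiSquare k)
  rw [variance_pow_chiSquare hk] at h
  linarith

lemma chiMoment_two_mul_div {k : ℕ} (hk : 0 < k) (m : ℕ) :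
    chiMoment k (2 * m) / chiMoment k m ^ 2 = 1 + hFactor m k / k := by
  have hk' : (k : ℝ) ≠ 0 := by exact_mod_cast hk.ne'
  have := (chiMoment_pos hk m).ne'
  rw [hFactor, variance_pow_chiSquare hk]
  field_simp
  ring

end ChiVariance

section RadialMoments

variable {ν : Measure ℝ} [IsProbabilityMeasure ν]

lemma integrable_even_pow_of_le {k l : ℕ} (hkl : k ≤ l)
    (h : Integrable (fun x : ℝ => x ^ (2 * l)) ν) : Integrable (fun x : ℝ => x ^ (2 * k)) ν := by
  refine ((integrable_const (1 : ℝ)).add h).mono' (by fun_prop)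
    (Filter.Eventually.of_forall fun x => ?_)
  rw [Real.norm_of_nonneg ((even_two_mul k).pow_nonneg x), Pi.add_apply, pow_mul, pow_mul]
  rcases le_total (x ^ 2) 1 with hx | hx
  · have := pow_le_one₀ (n := k) (sq_nonneg x) hx
    have : 0 ≤ (x ^ 2) ^ l := by positivity
    linarith
  · have := pow_le_pow_right₀ hx hkl
    linarith

/-- Jensen for `t ↦ t ^ m`; with `E ξ² = p` it gives `θ_m ≥ 1`. -/
lemma pow_integral_sq_le {m : ℕ} (hm : 1 ≤ m) (h : Integrable (fun x : ℝ => x ^ (2 * m)) ν) :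
    (∫ x, x ^ 2 ∂ν) ^ m ≤ ∫ x, x ^ (2 * m) ∂ν := by
  have h2 : Integrable (fun x : ℝ => x ^ 2) ν := by
    simpa using integrable_even_pow_of_le hm h
  have := (convexOn_pow (𝕜 := ℝ) m).map_integral_le (f := fun x : ℝ => x ^ 2) (μ := ν)
    (by fun_prop) isClosed_Ici (Filter.Eventually.of_forall fun x => sq_nonneg x) h2
    (by simpa only [Function.comp_def, ← pow_mul] using h)
  simpa only [← pow_mul] using this

end RadialMoments

/-! ### Moments of a single observation's contribution -/

variable {p : ℕ} {S : Matrix (Fin p) (Fin p) ℝ} {A : Finset (Finset (Fin p))}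

/-- The contribution of a single observation to the blockwise aggregation estimator. -/
def observationEstimator (m : ℕ) (μ : EuclideanSpace ℝ (Fin p)) (S : Matrix (Fin p) (Fin p) ℝ)
    (A : Finset (Finset (Fin p))) (y : EuclideanSpace ℝ (Fin p)) : ℝ :=
  1 / (A.card : ℝ) * ∑ J ∈ A, 1 / cStar p m J.card * blockQuad μ S J y ^ m

/-- The factor of `observationEstimator` that depends on the direction only. -/
def directionFactor (m : ℕ) (S : Matrix (Fin p) (Fin p) ℝ)
    (A : Finset (Finset (Fin p))) (u : EuclideanSpace ℝ (Fin p)) : ℝ :=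
  1 / (A.card : ℝ) * ∑ J ∈ A, 1 / cStar p m J.card * ‖whiteningMap S J u‖ ^ (2 * m)

lemma bae_eq {n : ℕ} (m : ℕ) (μ : EuclideanSpace ℝ (Fin p))
    (y : Fin n → EuclideanSpace ℝ (Fin p)) :
    bae m μ S A y = 1 / (n : ℝ) * ∑ i, observationEstimator m μ S A (y i) := by
  simp only [bae, blockEstimator, observationEstimator, Finset.mul_sum]
  rw [Finset.sum_comm]
  refine Finset.sum_congr rfl fun i _ => Finset.sum_congr rfl fun J _ => ?_
  rw [one_div_mul_eq_div, one_div, one_div, one_div, one_div, mul_inv]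
  ring

lemma continuous_observationEstimator (m : ℕ) (μ : EuclideanSpace ℝ (Fin p)) :
    Continuous (observationEstimator m μ S A) := by
  unfold observationEstimator
  refine continuous_const.mul (continuous_finsetSum _ fun J _ => continuous_const.mul (.pow ?_ m))
  have h : Continuous fun y : EuclideanSpace ℝ (Fin p) => fun j : J => y j - μ j := by fun_prop
  exact h.dotProduct (continuous_const.matrix_mulVec h)

@[fun_prop]
lemma continuous_directionFactor (m : ℕ) : Continuous (directionFactor m S A) := by
  unfold directionFactor
  fun_prop

lemma observationEstimator_elliptical (hpd : ∀ J ∈ A, (block S J J).PosDef) (m : ℕ)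
    (μ u : EuclideanSpace ℝ (Fin p)) (x : ℝ) :
    observationEstimator m μ S A (μ + x • toEuclideanLin (matSqrt S) u) =
      x ^ (2 * m) * directionFactor m S A u := by
  rw [observationEstimator, directionFactor, mul_left_comm, Finset.mul_sum _ _ (x ^ (2 * m))]
  congr 1
  refine Finset.sum_congr rfl fun J hJ => ?_
  rw [blockQuad_elliptical (hpd J hJ).posSemidef, mul_pow, ← pow_mul, ← pow_mul]
  ring

lemma measurable_elliptical (μ : EuclideanSpace ℝ (Fin p)) (S : Matrix (Fin p) (Fin p) ℝ) :
    Measurable fun z : ℝ × EuclideanSpace ℝ (Fin p) =>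
      μ + z.1 • toEuclideanLin (matSqrt S) z.2 := by
  have h : Continuous fun x => toEuclideanLin (matSqrt S) x :=
    LinearMap.continuous_of_finiteDimensional _
  exact Continuous.measurable (by fun_prop)

lemma isProbabilityMeasure_ellipticalLaw (hp : 0 < p) (μ : EuclideanSpace ℝ (Fin p))
    (ν : Measure ℝ) [IsProbabilityMeasure ν] : IsProbabilityMeasure (ellipticalLaw μ S ν) := by
  have := isProbabilityMeasure_sphereUniform hp
  exact Measure.isProbabilityMeasure_map (measurable_elliptical μ S).aemeasurable

lemma integral_observationEstimator_pow (hp : 0 < p) (hpd : ∀ J ∈ A, (block S J J).PosDef) (m : ℕ)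
    (μ : EuclideanSpace ℝ (Fin p)) (ν : Measure ℝ) [IsProbabilityMeasure ν] (a : ℕ) :
    ∫ y, observationEstimator m μ S A y ^ a ∂(ellipticalLaw μ S ν) =
      (∫ x, x ^ (2 * m * a) ∂ν) * ∫ u, directionFactor m S A u ^ a ∂(sphereUniform p) := by
  have := isProbabilityMeasure_sphereUniform hp
  rw [ellipticalLaw, integral_map (measurable_elliptical μ S).aemeasurable
    (by exact ((continuous_observationEstimator m μ).pow a).aestronglyMeasurable), ← integral_prod_mul]
  simp only [observationEstimator_elliptical hpd, mul_pow, ← pow_mul]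

lemma memLp_observationEstimator (hp : 0 < p) (hpd : ∀ J ∈ A, (block S J J).PosDef) (m : ℕ)
    (μ : EuclideanSpace ℝ (Fin p)) (ν : Measure ℝ) [IsProbabilityMeasure ν]
    (hint : Integrable (fun x : ℝ => x ^ (2 * (2 * m))) ν) :
    MemLp (observationEstimator m μ S A) 2 (ellipticalLaw μ S ν) := by
  have := isProbabilityMeasure_sphereUniform hp
  have hc := continuous_observationEstimator (S := S) (A := A) m μ
  rw [memLp_two_iff_integrable_sq hc.aestronglyMeasurable, ellipticalLaw, integrable_map_measure
    (by exact (hc.pow 2).aestronglyMeasurable) (measurable_elliptical μ S).aemeasurable]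
  have h := hint.mul_prod (integrable_sphereUniform
    (f := fun u => directionFactor m S A u ^ 2) (by fun_prop))
  refine h.congr (Filter.Eventually.of_forall fun z => ?_)
  simp only [Function.comp_apply, observationEstimator_elliptical hpd, mul_pow, ← pow_mul]
  rw [mul_right_comm 2 m 2, ← mul_assoc]

lemma integral_directionFactor (hS : S.PosSemidef) (hA : A.Nonempty) (hne : ∀ J ∈ A, J.Nonempty)
    (hpd : ∀ J ∈ A, (block S J J).PosDef) (m : ℕ) :
    ∫ u, directionFactor m S A u ∂(sphereUniform p) = ((p : ℝ) ^ m)⁻¹ := by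
  have hp : 0 < p := Fin.pos (hne _ hA.choose_spec).choose
  have hp' : (p : ℝ) ≠ 0 := by exact_mod_cast hp.ne'
  have hcard : (A.card : ℝ) ≠ 0 := by exact_mod_cast hA.card_ne_zero
  simp only [directionFactor]
  rw [integral_const_mul, integral_finsetSum _ fun J _ =>
    (integrable_sphereUniform (by fun_prop)).const_mul _]
  have h : ∀ J ∈ A, ∫ u, 1 / cStar p m J.card * ‖whiteningMap S J u‖ ^ (2 * m) ∂(sphereUniform p) =
      ((p : ℝ) ^ m)⁻¹ := by
    intro J hJ
    have hK := (hne J hJ).card_pos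
    have h1 := (chiMoment_pos hK m).ne'
    have h2 := (chiMoment_pos hp m).ne'
    rw [integral_const_mul, integral_norm_whiteningMap_pow hS (hpd J hJ) (hne J hJ),
      cStar_eq hK (by simpa using J.card_le_univ)]
    field_simp
  rw [Finset.sum_congr rfl h, Finset.sum_const, nsmul_eq_mul]
  field_simp

/-- Expand the square over pairs of blocks. The `|A|²` leading ones average to `1`; the excess is
the chi variance on the diagonal and the correlation bound off it. -/
lemma integral_directionFactor_sq_le (hS : S.PosSemidef) (hA : A.Nonempty)
    (hne : ∀ J ∈ A, J.Nonempty) (hpd : ∀ J ∈ A, (block S J J).PosDef) (m : ℕ) :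
    (p : ℝ) ^ (2 * m) * ∫ u, directionFactor m S A u ^ 2 ∂(sphereUniform p) ≤
      chiMoment p m ^ 2 / chiMoment p (2 * m) *
        (1 + 1 / (A.card : ℝ) ^ 2 * ∑ J ∈ A, hFactor m J.card / J.card +
          correlationConst m * (1 / (A.card : ℝ) ^ 2 * crossBlockSum S A)) := by
  have hp : 0 < p := Fin.pos (hne _ hA.choose_spec).choose
  have hp' : (p : ℝ) ≠ 0 := by exact_mod_cast hp.ne'
  have hcard : (A.card : ℝ) ≠ 0 := by exact_mod_cast hA.card_ne_zero
  set a := chiMoment p m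
  set b := chiMoment p (2 * m)
  have ha : 0 < a := chiMoment_pos hp m
  have hb : 0 < b := chiMoment_pos hp (2 * m)
  set G : Finset (Fin p) × Finset (Fin p) → ℝ := fun q => ∫ u, ‖whiteningMap S q.1 u‖ ^ (2 * m) *
    ‖whiteningMap S q.2 u‖ ^ (2 * m) ∂(sphereUniform p)
  set g : Finset (Fin p) × Finset (Fin p) → ℝ := fun q =>
    b * G q / (chiMoment q.1.card m * chiMoment q.2.card m)
  have hsq : ∀ u, directionFactor m S A u ^ 2 = 1 / (A.card : ℝ) ^ 2 * ∑ q ∈ A ×ˢ A,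
      1 / (cStar p m q.1.card * cStar p m q.2.card) *
        (‖whiteningMap S q.1 u‖ ^ (2 * m) * ‖whiteningMap S q.2 u‖ ^ (2 * m)) := by
    intro u
    rw [directionFactor, mul_pow, sq (∑ J ∈ A, _), Finset.sum_mul_sum, ← Finset.sum_product']
    congr 1
    · rw [div_pow, one_pow]
    · refine Finset.sum_congr rfl fun q _ => ?_
      simp only [one_div, mul_inv]
      ring
  have hL : (p : ℝ) ^ (2 * m) * ∫ u, directionFactor m S A u ^ 2 ∂(sphereUniform p) =
      a ^ 2 / b * (1 / (A.card : ℝ) ^ 2 * ∑ q ∈ A ×ˢ A, g q) := by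
    simp_rw [hsq]
    rw [integral_const_mul, integral_finsetSum _ fun q _ =>
      (integrable_sphereUniform (by fun_prop)).const_mul _, Finset.mul_sum, Finset.mul_sum,
      Finset.mul_sum, Finset.mul_sum]
    refine Finset.sum_congr rfl fun q hq => ?_
    obtain ⟨hq1, hq2⟩ := Finset.mem_product.1 hq
    have hK1 := (hne _ hq1).card_pos
    have hK2 := (hne _ hq2).card_pos
    have h1 := (chiMoment_pos hK1 m).ne'
    have h2 := (chiMoment_pos hK2 m).ne'
    rw [integral_const_mul, cStar_eq hK1 (by simpa using Finset.card_le_univ q.1),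
      cStar_eq hK2 (by simpa using Finset.card_le_univ q.2)]
    change _ * (_ * (1 / (p ^ m * (_ / a) * (p ^ m * (_ / a))) * G q)) = _
    simp only [g]
    rw [two_mul m, pow_add]
    field_simp
  have hdiag : ∀ J ∈ A, g (J, J) = 1 + hFactor m J.card / J.card := by
    intro J hJ
    have hK := (hne _ hJ).card_pos
    have h1 := (chiMoment_pos hK m).ne'
    rw [← chiMoment_two_mul_div hK]
    simp only [g, G]
    rw [integral_norm_whiteningMap_pow_mul_self hS (hpd J hJ) (hne J hJ)]
    change b * (_ / b) / _ = _
    field_simp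
  have hoff : ∀ q ∈ A.offDiag, g q ≤ 1 + correlationConst m *
      spectralNorm (matInvSqrt (block S q.1 q.1) * block S q.1 q.2 *
        matInvSqrt (block S q.2 q.2)) ^ 2 := by
    intro q hq
    obtain ⟨hq1, hq2, -⟩ := Finset.mem_offDiag.1 hq
    have hK1 := chiMoment_pos (hne _ hq1).card_pos m
    have hK2 := chiMoment_pos (hne _ hq2).card_pos m
    have h := integral_norm_whiteningMap_pow_mul_le hS (hpd _ hq1) (hpd _ hq2) (hne _ hq1)
      (hne _ hq2) m
    rw [le_div_iff₀ hb] at h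
    simp only [g]
    rw [div_le_iff₀ (by positivity), mul_comm b]
    exact h
  have hsum : ∑ q ∈ A ×ˢ A, g q ≤ (A.card : ℝ) ^ 2 + ∑ J ∈ A, hFactor m J.card / J.card +
      correlationConst m * crossBlockSum S A := by
    rw [← Finset.diag_union_offDiag, Finset.sum_union (Finset.disjoint_diag_offDiag _),
      Finset.sum_diag, Finset.sum_congr rfl hdiag]
    refine (add_le_add_right (Finset.sum_le_sum hoff) _).trans (le_of_eq ?_)
    rw [Finset.sum_add_distrib, Finset.sum_add_distrib, ← Finset.mul_sum, crossBlockSum]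
    simp only [Finset.sum_const, nsmul_eq_mul, mul_one, Finset.offDiag_card]
    rw [Nat.cast_sub (Nat.le_mul_self _)]
    push_cast
    ring
  rw [hL]
  refine mul_le_mul_of_nonneg_left ?_ (by positivity)
  calc 1 / (A.card : ℝ) ^ 2 * ∑ q ∈ A ×ˢ A, g q ≤ _ :=
        mul_le_mul_of_nonneg_left hsum (by positivity)
    _ = _ := by field_simp

lemma momentRatio_div_sq_le (hp : 0 < p) {m : ℕ} (hm : 1 ≤ m) (ν : Measure ℝ)
    [IsProbabilityMeasure ν] (hνp : ∫ x, x ^ 2 ∂ν = (p : ℝ))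
    (hint : Integrable (fun x : ℝ => x ^ (2 * (2 * m))) ν) :
    momentRatio p ν (2 * m) / momentRatio p ν m ^ 2 ≤ theta p ν (2 * m) := by
  have hp' : 0 < (p : ℝ) := by exact_mod_cast hp
  have hM : (p : ℝ) ^ m ≤ ∫ x, x ^ (2 * m) ∂ν := by
    rw [← hνp]
    exact pow_integral_sq_le hm (integrable_even_pow_of_le (by omega) hint)
  have hM2 : 0 ≤ ∫ x, x ^ (2 * (2 * m)) ∂ν :=
    integral_nonneg fun x => (even_two_mul _).pow_nonneg x
  have ha := chiMoment_pos hp m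
  have hb := chiMoment_pos hp (2 * m)
  have hab := sq_chiMoment_le hp m
  have hpm : 0 < (p : ℝ) ^ m := by positivity
  have hMpos := hpm.trans_le hM
  rw [momentRatio, momentRatio, theta]
  set M := ∫ x, x ^ (2 * m) ∂ν
  set M2 := ∫ x, x ^ (2 * (2 * m)) ∂ν
  calc M2 / chiMoment p (2 * m) / (M / chiMoment p m) ^ 2
      = M2 / M ^ 2 * (chiMoment p m ^ 2 / chiMoment p (2 * m)) := by field_simp
    _ ≤ M2 / M ^ 2 * 1 :=
        mul_le_mul_of_nonneg_left ((div_le_one hb).2 hab) (by positivity)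
    _ ≤ M2 / (p : ℝ) ^ (2 * m) := by
        rw [mul_one, mul_comm 2 m, pow_mul]
        gcongr

end BlockwiseAggregation

end
-- Assembly of the variance bound
theorem theorem7 (m : ℕ) (hm : 2 ≤ m) (C : ℝ) :
    ∃ Cm : ℝ, 0 < Cm ∧
      ∀ (p n : ℕ) (_hn : 0 < n)
        (μ : EuclideanSpace ℝ (Fin p)) (S : Matrix (Fin p) (Fin p) ℝ) (_hS : S.PosSemidef)
        -- `ν` is the law of the nonnegative radial variable `ξ`, normalized by `E ξ² = p`
        (ν : Measure ℝ) (_hν : IsProbabilityMeasure ν) (_hν0 : ∀ᵐ x ∂ν, 0 ≤ x)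
        (_hνp : ∫ x, x ^ 2 ∂ν = (p : ℝ))
        (_hint : Integrable (fun x : ℝ => x ^ (2 * (2 * m))) ν)
        (_hC : BlockwiseAggregation.theta p ν (2 * m) ≤ C)
        -- a nonempty collection of nonempty, pairwise disjoint blocks
        (A : Finset (Finset (Fin p))) (_hA : A.Nonempty) (_hne : ∀ J ∈ A, J.Nonempty)
        (_hdisj : ∀ I ∈ A, ∀ J ∈ A, I ≠ J → Disjoint I J)
        (_hpd : ∀ J ∈ A, (BlockwiseAggregation.block S J J).PosDef)
        (Ω : Type*) (_mΩ : MeasurableSpace Ω) (P : Measure Ω) (_hP : IsProbabilityMeasure P)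
        (Y : Fin n → Ω → EuclideanSpace ℝ (Fin p)) (_hindep : iIndepFun Y P)
        (_hlaw : ∀ i, HasLaw (Y i) (BlockwiseAggregation.ellipticalLaw μ S ν) P),
        MemLp (fun ω => BlockwiseAggregation.bae m μ S A (fun i => Y i ω)) 2 P ∧
        ∫ ω, BlockwiseAggregation.bae m μ S A (fun i => Y i ω) ∂P =
          BlockwiseAggregation.theta p ν m ∧
        Var[fun ω => BlockwiseAggregation.bae m μ S A (fun i => Y i ω); P] /
            BlockwiseAggregation.theta p ν m ^ 2 ≤
          1 / (n : ℝ) *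
              ((BlockwiseAggregation.momentRatio p ν (2 * m) -
                  BlockwiseAggregation.momentRatio p ν m ^ 2) /
                BlockwiseAggregation.momentRatio p ν m ^ 2) +
            1 / ((n : ℝ) * p) *
              (BlockwiseAggregation.momentRatio p ν (2 * m) /
                BlockwiseAggregation.momentRatio p ν m ^ 2) *
              BlockwiseAggregation.blockDivisionFactor m A +
            Cm / n * (1 / (A.card : ℝ) ^ 2) * BlockwiseAggregation.crossBlockSum S A := by
  open BlockwiseAggregation in
  have hc := correlationConst_nonneg m
  -- `|C|` bounds `r_{2m}/r_m²`; the added `1` only ensures positivity.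
  refine ⟨|C| * correlationConst m + 1, by positivity, ?_⟩
  intro p n hn μ S hS ν hν _ hνp hint hC A hA hne _ hpd Ω _ P hP Y hindep hlaw
  have hp : 0 < p := Fin.pos (hne _ hA.choose_spec).choose
  have hp' : 0 < (p : ℝ) := by exact_mod_cast hp
  have hn' : 0 < (n : ℝ) := by exact_mod_cast hn
  have hcard : 0 < (A.card : ℝ) := by exact_mod_cast hA.card_pos
  have := isProbabilityMeasure_ellipticalLaw (S := S) hp μ ν
  set T := observationEstimator m μ S A
  have hTc : Continuous T := continuous_observationEstimator m μ
  have hT2 : MemLp T 2 (ellipticalLaw μ S ν) := memLp_observationEstimator hp hpd m μ ν hint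
  have hT1 : ∫ y, T y ∂(ellipticalLaw μ S ν) = theta p ν m := by
    have h := integral_observationEstimator_pow (A := A) hp hpd m μ ν 1
    simp only [pow_one, mul_one, integral_directionFactor hS hA hne hpd] at h
    rw [theta, div_eq_mul_inv]
    exact h
  have hX2 : ∀ i, MemLp (T ∘ Y i) 2 P := fun i =>
    (memLp_map_measure_iff hTc.aestronglyMeasurable (hlaw i).aemeasurable).1
      ((hlaw i).map_eq ▸ hT2)
  have hXm : ∀ i, ∫ ω, (T ∘ Y i) ω ∂P = theta p ν m := fun i => by
    rw [(hlaw i).integral_comp hTc.aestronglyMeasurable, hT1]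
  have hXv : ∀ i, Var[T ∘ Y i; P] = Var[T; ellipticalLaw μ S ν] := fun i => by
    rw [← (hlaw i).map_eq, variance_map hTc.measurable.aemeasurable (hlaw i).aemeasurable]
  have hbae : (fun ω => bae m μ S A (fun i => Y i ω)) =
      fun ω => 1 / (n : ℝ) * (∑ i, T ∘ Y i) ω := by
    ext ω
    rw [bae_eq, Finset.sum_apply]
    rfl
  have hvar : Var[fun ω => bae m μ S A (fun i => Y i ω); P] =
      1 / (n : ℝ) * Var[T; ellipticalLaw μ S ν] := by
    rw [hbae, variance_const_mul, IndepFun.variance_sum (fun i _ => hX2 i)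
      fun i _ j _ hij => (hindep.indepFun hij).comp hTc.measurable hTc.measurable]
    simp only [hXv, Finset.sum_const, Finset.card_univ, Fintype.card_fin, nsmul_eq_mul]
    field_simp
  refine ⟨?_, ?_, ?_⟩
  · rw [hbae]
    exact (memLp_finsetSum' _ fun i _ => hX2 i).const_mul _
  · rw [hbae, integral_const_mul]
    simp only [Finset.sum_apply]
    rw [integral_finsetSum _ fun i _ => (hX2 i).integrable one_le_two]
    simp only [hXm, Finset.sum_const, Finset.card_univ, Fintype.card_fin, nsmul_eq_mul]
    field_simp
  · have hM : (p : ℝ) ^ m ≤ ∫ x, x ^ (2 * m) ∂ν := by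
      rw [← hνp]
      exact pow_integral_sq_le (by omega) (integrable_even_pow_of_le (by omega) hint)
    have hMpos : 0 < ∫ x, x ^ (2 * m) ∂ν := lt_of_lt_of_le (by positivity) hM
    have hM2 : 0 ≤ ∫ x, x ^ (2 * (2 * m)) ∂ν :=
      integral_nonneg fun x => (even_two_mul _).pow_nonneg x
    have ha := chiMoment_pos hp m
    have hb := chiMoment_pos hp (2 * m)
    have hcross : 0 ≤ crossBlockSum S A := Finset.sum_nonneg fun _ _ => sq_nonneg _
    have hle := momentRatio_div_sq_le hp (by omega : 1 ≤ m) ν hνp hint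
    set κ := momentRatio p ν (2 * m) / momentRatio p ν m ^ 2 with hκ
    have hr : 0 < momentRatio p ν m := div_pos hMpos ha
    have hκC : κ ≤ |C| := (hle.trans hC).trans (le_abs_self C)
    have hθ : 0 < theta p ν m := div_pos hMpos (by positivity)
    have hV : Var[T; ellipticalLaw μ S ν] / theta p ν m ^ 2 ≤
        κ * (1 + 1 / (A.card : ℝ) ^ 2 * ∑ J ∈ A, hFactor m J.card / J.card +
          correlationConst m * (1 / (A.card : ℝ) ^ 2 * crossBlockSum S A)) - 1 := by
      have h := integral_observationEstimator_pow (A := A) hp hpd m μ ν 2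
      have hD := integral_directionFactor_sq_le hS hA hne hpd m
      rw [variance_eq_sub hT2, hT1, sub_div, div_self (by positivity)]
      simp only [Pi.pow_apply]
      refine sub_le_sub_right ?_ 1
      rw [h, show 2 * m * 2 = 2 * (2 * m) by ring]
      set D := ∫ u, directionFactor m S A u ^ 2 ∂(sphereUniform p)
      set M := ∫ x, x ^ (2 * m) ∂ν
      set M2 := ∫ x, x ^ (2 * (2 * m)) ∂ν
      calc M2 * D / theta p ν m ^ 2 = M2 / M ^ 2 * ((p : ℝ) ^ (2 * m) * D) := by
            have h2 : (p : ℝ) ^ (2 * m) = ((p : ℝ) ^ m) ^ 2 := by rw [mul_comm, pow_mul]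
            rw [theta, h2]
            change M2 * D / (M / _) ^ 2 = _
            field_simp
        _ ≤ _ := mul_le_mul_of_nonneg_left hD (by positivity)
        _ = _ := by
            rw [hκ, momentRatio, momentRatio, ← mul_assoc]
            congr 1
            change _ = M2 / _ / (M / _) ^ 2
            field_simp
    have e1 : (momentRatio p ν (2 * m) - momentRatio p ν m ^ 2) / momentRatio p ν m ^ 2 =
        κ - 1 := by
      rw [sub_div, div_self (by positivity)]
    rw [hvar, mul_div_assoc, e1]
    set X := 1 / (A.card : ℝ) ^ 2 * crossBlockSum S A with hX
    have hX0 : 0 ≤ X := by positivity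
    have hlast : κ * (correlationConst m * X) ≤ (|C| * correlationConst m + 1) * X := by
      have := mul_le_mul_of_nonneg_right hκC (by positivity : 0 ≤ correlationConst m * X)
      linarith
    -- Expanding `κ(1 + H + cX) - 1` as `(κ - 1) + κH + κcX` gives the three terms of the bound;
    -- only the last uses `κ ≤ |C|`.
    calc _ ≤ 1 / (n : ℝ) * (_ - 1) := mul_le_mul_of_nonneg_left hV (by positivity)
      _ ≤ 1 / (n : ℝ) * ((κ - 1) + κ * (1 / (A.card : ℝ) ^ 2 *
            ∑ J ∈ A, hFactor m J.card / J.card) + (|C| * correlationConst m + 1) * X) := by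
          refine mul_le_mul_of_nonneg_left ?_ (by positivity)
          linarith
      _ = _ := by
          rw [blockDivisionFactor, hX]
          field_simp
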